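/- Let $d\ge 3$ be an integer. For $\alpha\in\mathbb R$ let $\psi_\alpha:[0,\infty)\to\mathbb R$ be the unique global solution of $$\psi''+\Big(\frac{d-1}{\rho}+\frac{\rho}{2}\Big)\psi'-\frac{d-1}{2\rho^2}\sin(2\psi)=0\quad(\rho>0),\qquad \psi(0)=0,\quad \psi'(0)=\alpha$$ (existence, uniqueness, and differentiability of $\alpha\mapsto\psi_\alpha(\rho)$ for every $\rho\ge 0$ are part of the claim). Put $\varphi_\alpha(\rho)=\frac{d}{d\alpha}\psi_\alpha(\rho)$ and define, in $[-\infty,\infty]$, $$\alpha^*=\sup\{\beta>0:\ \varphi_\alpha(\rho)>0\text{ for all }\rho>0\text{ and all }\alpha\in(0,\beta)\},$$ $$\alpha_0=\sup\{\beta>0:\ \psi_\alpha(\rho)<\tfrac{\pi}{2}\text{ for all }\rho\ge 0\text{ and all }\alpha\in(0,\beta)\}.$$ Then: (i) For every $\alpha$, the limit $\varphi_\alpha(\infty)=\lim_{\rho\to\infty}\varphi_\alpha(\rho)$ exists in $\mathbb R$. (ii) If $3\le d\le 6$, then $0<\alpha_0<\alpha^*<\infty$, and the limit $\psi_{\alpha^*}(\infty)=\lim_{\rho\to\infty}\psi_{\alpha^*}(\rho)$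 exists and satisfies $\psi_{\alpha^*}(\infty)>\frac{\pi}{2}$. Furthermore, there is a finite set $F\subset[\alpha_0,\alpha^*)$ such that $\varphi_\alpha(\infty)>0$ for all $\alpha\in(0,\alpha^*)\setminus F$. (iii) If $d\ge 7$, then $\alpha_0=\alpha^*=\infty$, and $\varphi_\alpha(\infty)>0$ for all $\alpha>0$. -/

import Mathlib

open Filter Topology

namespace Expander

/-- `f` (restricted to `[0, ∞)`) is a global solution of the corotational expander problem
`ψ'' + ((d-1)/ρ + ρ/2) ψ' - (d-1)/(2ρ²) sin (2ψ) = 0` on `(0, ∞)`, `ψ(0) = 0`, `ψ'(0) = α`,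
where `ψ'(0)` is the right derivative. Nothing is asked on `(-∞, 0)`. -/
structure IsProfile (d : ℕ) (α : ℝ) (f : ℝ → ℝ) : Prop where
  zero : f 0 = 0
  slope : HasDerivWithinAt f α (Set.Ici 0) 0
  diff : ∀ ρ : ℝ, 0 < ρ → DifferentiableAt ℝ f ρ
  diff_deriv : ∀ ρ : ℝ, 0 < ρ → DifferentiableAt ℝ (deriv f) ρ
  ode : ∀ ρ : ℝ, 0 < ρ →
    deriv (deriv f) ρ + (((d : ℝ) - 1) / ρ + ρ / 2) * deriv f ρ
      - ((d : ℝ) - 1) / (2 * ρ ^ 2) * Real.sin (2 * f ρ) = 0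

/-- The expander profile `ψ_α`: the solution of the problem above (it is unique on `[0, ∞)`; only
values at `ρ ≥ 0` are meaningful). -/
noncomputable def psi (d : ℕ) (α : ℝ) : ℝ → ℝ :=
  Classical.epsilon (IsProfile d α)

/-- `φ_α(ρ) = d/dα ψ_α(ρ)`. -/
noncomputable def phi (d : ℕ) (α ρ : ℝ) : ℝ :=
  deriv (fun a : ℝ => psi d a ρ) α

/-- `α* = sup {β > 0 : φ_α(ρ) > 0 for all ρ > 0 and all α ∈ (0, β)}`, in the extended reals. -/
noncomputable def alphaStar (d : ℕ) : EReal :=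
  sSup ((fun β : ℝ => (β : EReal)) ''
    {β : ℝ | 0 < β ∧ ∀ α ∈ Set.Ioo 0 β, ∀ ρ : ℝ, 0 < ρ → 0 < phi d α ρ})

/-- `α₀ = sup {β > 0 : ψ_α(ρ) < π/2 for all ρ ≥ 0 and all α ∈ (0, β)}`, in the extended reals. -/
noncomputable def alphaZero (d : ℕ) : EReal :=
  sSup ((fun β : ℝ => (β : EReal)) ''
    {β : ℝ | 0 < β ∧ ∀ α ∈ Set.Ioo 0 β, ∀ ρ : ℝ, 0 ≤ ρ → psi d α ρ < Real.pi / 2})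

end Expander

/-!
The equation is written in divergence form `(w ψ')' = (k / 2) w sin (2ψ) / ρ²`, with `k = d - 1` and
`w = ρ^k e^{ρ²/4}`.

*Existence, analyticity, limits at infinity.* Put `m = ρ / √(2k + 6 + ρ²)` and `ψ = β m + m³ v`,
with `v` bounded and continuous on `(0, ∞)`. Since `m³` is a supersolution with margin `3`
(`hasDerivAt_wt_dcube`), inverting the principal part gives an equation `v = T(β, v)` in which `T`
is `1/3`-Lipschitz in `v` (`lipschitz_picard`). Moreover `T` is real analytic on a Banach algebra,
because `sin x = x + x³ S(x²)` with `S` entire. So the fixed point depends analytically on the slope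
(`contDiff_fixpt`), uniformly up to `ρ = ∞`. This yields `ψ_α`, `φ_α`, their limits at infinity,
and the analyticity of `α ↦ φ_α(∞)`. Uniqueness (`IsProfile.eq_of_nonneg`) is a comparison of fluxes
with the supersolution `m`.

*Positivity of `φ_α`.* In the variable `log ρ` the equation is a damped pendulum. The function
`sin (2ψ)` satisfies the linearised equation up to the term `-4 sin (2ψ) (ρψ')²`, hence it is a
positive supersolution as long as `0 < ψ < π/2`, and `φ_α ≥ sin (2ψ_α) / (2α)` there
(`IsVariation.sturm`). If `ψ_α` increases to exactly `π/2`, this bound degenerates at infinity, but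
the Wronskian with `sin (2ψ)` still forces `φ_α(∞) > 0`
(`IsVariation.lim_pos_of_tendsto_pi_div_two`). So a profile below `π/2` has `φ_α > 0` on `(0, ∞]`.

*Overdamped case `k ≥ 6`.* The curve `ρψ' = sin (2ψ)` is a barrier in the phase plane, whence
`ψ_α < π/2` for all `α > 0` (`IsFlow.lt_pi_div_two_of_six_le`).

*Underdamped case `2 ≤ k ≤ 5`.* A steep profile is close to the equilibrium `π/2` during a long
logarithmic time, where the linearisation oscillates; a Riccati argument shows that `φ_α` cannot
stay positive for all slopes (`exists_var_nonpos`), so `α₀` and `α*` are finite. By continuity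
`ψ_{α₀} < π/2`, and `ψ_{α₀}(∞) = π/2` since staying below `π/2` on `[0, ∞]` is an open condition.
Then `φ_{α₀} > 0` on `(0, ∞]`, which is open too, so `α₀ < α*`; and `ψ_α(∞)` is nondecreasing on
`[α₀, α*]` with positive derivative at `α₀`, so `ψ_{α*}(∞) > π/2`. Finally `φ_α(∞) ≥ 0` is analytic
and not identically zero, so it has finitely many zeros in `[α₀, α*]`.
-/

namespace Expander

open Set MeasureTheory BoundedContinuousFunction
open scoped ContDiff

/-! ### Weights and explicit supersolutions -/

/-- The weight `ρ^k e^{ρ²/4}` which puts the expander operator in divergence form: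
`y'' + (k/ρ + ρ/2) y' = (w y')' / w`. -/
noncomputable def wt (k : ℕ) (ρ : ℝ) : ℝ := ρ ^ k * Real.exp (ρ ^ 2 / 4)

/-- The factor `(2k + 6 + ρ²)^{-1/2}`. -/
noncomputable def rsq (k : ℕ) (ρ : ℝ) : ℝ := (√(2 * k + 6 + ρ ^ 2))⁻¹

/-- The bounded profile `m(ρ) = ρ / √(2k + 6 + ρ²)`. It is asymptotically linear at `0`, and the
constant `2k + 6` is the one for which both `m` and `m³` are explicit supersolutions of the
linearised operator. -/
noncomputable def base (k : ℕ) (ρ : ℝ) : ℝ := ρ * rsq k ρ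

lemma wt_pos (k : ℕ) {ρ : ℝ} (h : 0 < ρ) : 0 < wt k ρ := by unfold wt; positivity

lemma continuous_wt (k : ℕ) : Continuous (wt k) := by unfold wt; fun_prop

lemma hasDerivAt_wt (k : ℕ) {ρ : ℝ} (h : 0 < ρ) :
    HasDerivAt (wt k) (wt k ρ * (k / ρ + ρ / 2)) ρ := by
  have h1 := (hasDerivAt_pow k ρ).mul (((hasDerivAt_pow 2 ρ).div_const 4).exp)
  refine h1.congr_deriv ?_
  unfold wt
  rcases k with _ | k
  · simp; ring
  · have := h.ne'
    push_cast
    field_simp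
    ring

lemma rsq_arg_pos (k : ℕ) (ρ : ℝ) : (0 : ℝ) < 2 * k + 6 + ρ ^ 2 := by positivity

lemma rsq_pos (k : ℕ) (ρ : ℝ) : 0 < rsq k ρ :=
  inv_pos.2 (Real.sqrt_pos.2 (rsq_arg_pos k ρ))

lemma rsq_sq (k : ℕ) (ρ : ℝ) : rsq k ρ ^ 2 * (2 * k + 6 + ρ ^ 2) = 1 := by
  unfold rsq
  rw [inv_pow, Real.sq_sqrt (rsq_arg_pos k ρ).le, inv_mul_cancel₀ (rsq_arg_pos k ρ).ne']

lemma hasDerivAt_rsq (k : ℕ) (ρ : ℝ) : HasDerivAt (rsq k) (-ρ * rsq k ρ ^ 3) ρ := by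
  have h1 : HasDerivAt (fun ρ : ℝ => 2 * (k : ℝ) + 6 + ρ ^ 2) (2 * ρ) ρ := by
    simpa using (hasDerivAt_pow 2 ρ).const_add (2 * (k : ℝ) + 6)
  have h2 := (h1.sqrt (rsq_arg_pos k ρ).ne').inv (Real.sqrt_pos.2 (rsq_arg_pos k ρ)).ne'
  refine h2.congr_deriv ?_
  unfold rsq
  have := (Real.sqrt_pos.2 (rsq_arg_pos k ρ)).ne'
  field_simp

lemma continuous_rsq (k : ℕ) : Continuous (rsq k) :=
  continuous_iff_continuousAt.2 fun ρ => (hasDerivAt_rsq k ρ).continuousAt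

lemma continuous_base (k : ℕ) : Continuous (base k) := by
  unfold base; exact continuous_id.mul (continuous_rsq k)

lemma base_pos (k : ℕ) {ρ : ℝ} (h : 0 < ρ) : 0 < base k ρ := mul_pos h (rsq_pos k ρ)

lemma base_sq (k : ℕ) (ρ : ℝ) : base k ρ ^ 2 = 1 - (2 * k + 6) * rsq k ρ ^ 2 := by
  have := rsq_sq k ρ
  unfold base
  linear_combination this

lemma base_lt_one (k : ℕ) (ρ : ℝ) : base k ρ < 1 := by
  have h := base_sq k ρ
  have h2 : 0 < (2 * (k : ℝ) + 6) * rsq k ρ ^ 2 := by have := rsq_pos k ρ; positivity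
  nlinarith [sq_nonneg (base k ρ)]

lemma hasDerivAt_base (k : ℕ) (ρ : ℝ) :
    HasDerivAt (base k) ((2 * k + 6) * rsq k ρ ^ 3) ρ := by
  have h := (hasDerivAt_id ρ).mul (hasDerivAt_rsq k ρ)
  refine h.congr_deriv ?_
  have := rsq_sq k ρ
  simp only [id]
  linear_combination (- rsq k ρ) * this

lemma base_zero (k : ℕ) : base k 0 = 0 := by simp [base]

lemma tendsto_base_atTop (k : ℕ) : Tendsto (base k) atTop (𝓝 1) := by
  have h1 : Tendsto (rsq k) atTop (𝓝 0) := by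
    unfold rsq
    refine tendsto_inv_atTop_zero.comp (Real.tendsto_sqrt_atTop.comp ?_)
    exact tendsto_atTop_add_const_left _ _ (tendsto_pow_atTop two_ne_zero)
  have h2 : Tendsto (fun ρ => √(1 - (2 * (k : ℝ) + 6) * rsq k ρ ^ 2)) atTop (𝓝 1) := by
    have : Tendsto (fun ρ => √(1 - (2 * (k : ℝ) + 6) * rsq k ρ ^ 2)) atTop
      (𝓝 (√(1 - (2 * (k : ℝ) + 6) * 0 ^ 2))) := (((h1.pow 2).const_mul _).const_sub _).sqrt
    simpa using this
  refine h2.congr' ?_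
  filter_upwards [eventually_gt_atTop 0] with ρ hρ
  rw [← base_sq, Real.sqrt_sq (base_pos k hρ).le]

/-- Derivative of `base k ^ 3`. -/
noncomputable def dcube (k : ℕ) (ρ : ℝ) : ℝ := 3 * (2 * k + 6) * ρ ^ 2 * rsq k ρ ^ 5

lemma hasDerivAt_base_cube (k : ℕ) (ρ : ℝ) :
    HasDerivAt (fun ρ => base k ρ ^ 3) (dcube k ρ) ρ := by
  refine ((hasDerivAt_base k ρ).pow 3).congr_deriv ?_
  simp [dcube, base]; ring

lemma dcube_nonneg (k : ℕ) (ρ : ℝ) : 0 ≤ dcube k ρ := by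
  have := rsq_pos k ρ
  unfold dcube; positivity

lemma continuous_dcube (k : ℕ) : Continuous (dcube k) := by
  have := continuous_rsq k
  unfold dcube; fun_prop

/-- The function `m` is a supersolution: `ρ² (w m')' / w = m (k + 3 m⁴)`. -/
lemma hasDerivAt_wt_dbase (k : ℕ) {ρ : ℝ} (h : 0 < ρ) :
    HasDerivAt (fun ρ => wt k ρ * ((2 * k + 6) * rsq k ρ ^ 3))
      (wt k ρ * (base k ρ * (k + 3 * base k ρ ^ 4) / ρ ^ 2)) ρ := by
  have h1 := (hasDerivAt_wt k h).mul (((hasDerivAt_rsq k ρ).fun_pow 3).const_mul (2 * (k : ℝ) + 6))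
  refine h1.congr_deriv ?_
  have hr := rsq_sq k ρ
  have hr0 := (rsq_pos k ρ).ne'
  have hne := h.ne'
  unfold base
  generalize rsq k ρ = r at *
  have hk : (k : ℝ) = (1 / r ^ 2 - ρ ^ 2 - 6) / 2 := by
    field_simp
    linear_combination hr
  rw [mul_assoc, ← mul_add]
  congr 1
  rw [hk]
  field_simp
  push_cast
  ring

/-- The function `m³` is a supersolution with a threefold margin:
`ρ² (w (m³)')' / w = m³ (3k + 9 m⁴ + 6 (1 - m²)²)`. -/
lemma hasDerivAt_wt_dcube (k : ℕ) {ρ : ℝ} (h : 0 < ρ) :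
    HasDerivAt (fun ρ => wt k ρ * dcube k ρ)
      (wt k ρ * (base k ρ ^ 3 *
        (3 * k + 9 * base k ρ ^ 4 + 6 * (1 - base k ρ ^ 2) ^ 2) / ρ ^ 2)) ρ := by
  have h1 := (hasDerivAt_wt k h).mul (((((hasDerivAt_pow 2 ρ).const_mul (3 * (2 * (k : ℝ) + 6)))).mul
    ((hasDerivAt_rsq k ρ).fun_pow 5)))
  refine h1.congr_deriv ?_
  have hr := rsq_sq k ρ
  have hr0 := (rsq_pos k ρ).ne'
  have hne := h.ne'
  unfold base
  simp only [Pi.mul_apply]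
  generalize rsq k ρ = r at *
  have hk : (k : ℝ) = (1 / r ^ 2 - ρ ^ 2 - 6) / 2 := by
    field_simp
    linear_combination hr
  rw [mul_assoc, ← mul_add]
  congr 1
  rw [hk]
  field_simp
  push_cast
  ring

/-! ### The solution operator of the divergence-form equation -/

lemma primitive_of_bounded {f b : ℝ → ℝ} (hf : ContinuousOn f (Ioi 0)) (hb : Continuous b)
    (hle : ∀ t, 0 < t → |f t| ≤ b t) :
    (∀ s, 0 ≤ s → IntervalIntegrable f volume 0 s) ∧
      ∀ s, 0 < s → HasDerivAt (fun s => ∫ t in (0 : ℝ)..s, f t) (f s) s := by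
  have hint : ∀ s, 0 ≤ s → IntervalIntegrable f volume 0 s := by
    intro s hs
    refine (hb.intervalIntegrable 0 s).mono_fun' ?_ ?_
    · rw [uIoc_of_le hs]
      exact (hf.mono Ioc_subset_Ioi_self).aestronglyMeasurable measurableSet_Ioc
    · rw [uIoc_of_le hs]
      exact (ae_restrict_mem measurableSet_Ioc).mono fun t ht => hle t ht.1
  refine ⟨hint, fun s hs => ?_⟩
  exact intervalIntegral.integral_hasDerivAt_right (hint s hs.le)
    (hf.stronglyMeasurableAtFilter isOpen_Ioi s hs) (hf.continuousAt (Ioi_mem_nhds hs))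

/-- A function on `[0, ∞)` with nonnegative derivative on `(0, ∞)` is monotone. -/
lemma monotoneOn_Ici_of_hasDerivAt {f f' : ℝ → ℝ} (hc : ContinuousOn f (Ici 0))
    (hd : ∀ t, 0 < t → HasDerivAt f (f' t) t) (hn : ∀ t, 0 < t → 0 ≤ f' t) :
    MonotoneOn f (Ici 0) := by
  refine monotoneOn_of_deriv_nonneg (convex_Ici 0) hc ?_ ?_
  · rw [interior_Ici]
    exact fun t ht => (hd t ht).differentiableAt.differentiableWithinAt
  · rw [interior_Ici]
    intro t ht
    rw [(hd t ht).deriv]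
    exact hn t ht

lemma continuousOn_primitive_Ici {f : ℝ → ℝ}
    (hi : ∀ s, 0 ≤ s → IntervalIntegrable f volume 0 s) :
    ContinuousOn (fun s => ∫ t in (0 : ℝ)..s, f t) (Ici 0) := by
  intro s hs
  have hs : 0 ≤ s := hs
  have h1 := intervalIntegral.continuousOn_primitive_interval' (a := 0)
    (hi (s + 1) (by linarith)) left_mem_uIcc
  rw [uIcc_of_le (by linarith)] at h1
  refine (h1 s ⟨hs, by linarith⟩).mono_of_mem_nhdsWithin ?_
  rw [mem_nhdsWithin]
  exact ⟨Iio (s + 1), isOpen_Iio, by simp, fun x hx => ⟨hx.2, hx.1.le⟩⟩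

lemma abs_primitive_le {f B B' : ℝ → ℝ}
    (hi : ∀ s, 0 ≤ s → IntervalIntegrable f volume 0 s)
    (hd : ∀ s, 0 < s → HasDerivAt (fun s => ∫ t in (0 : ℝ)..s, f t) (f s) s)
    (hB : ContinuousOn B (Ici 0)) (hB0 : B 0 = 0) (hBd : ∀ t, 0 < t → HasDerivAt B (B' t) t)
    (hle : ∀ t, 0 < t → |f t| ≤ B' t) {s : ℝ} (hs : 0 ≤ s) :
    |∫ t in (0 : ℝ)..s, f t| ≤ B s := by
  have hc := continuousOn_primitive_Ici hi
  have h1 := monotoneOn_Ici_of_hasDerivAt (hB.sub hc) (fun t ht => (hBd t ht).sub (hd t ht))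
    (fun t ht => by have := abs_le.1 (hle t ht); linarith) self_mem_Ici hs hs
  have h2 := monotoneOn_Ici_of_hasDerivAt (hB.add hc) (fun t ht => (hBd t ht).add (hd t ht))
    (fun t ht => by have := abs_le.1 (hle t ht); linarith) self_mem_Ici hs hs
  simp [hB0] at h1 h2
  exact abs_le.2 ⟨by linarith, by linarith⟩

/-- Extension by zero of a bounded continuous function on `(0, ∞)`. -/
noncomputable def extz (g : Ioi (0 : ℝ) →ᵇ ℝ) (t : ℝ) : ℝ :=
  if h : 0 < t then g ⟨t, h⟩ else 0

lemma extz_of_pos (g : Ioi (0 : ℝ) →ᵇ ℝ) {t : ℝ} (h : 0 < t) : extz g t = g ⟨t, h⟩ := by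
  simp [extz, h]

lemma abs_extz_le (g : Ioi (0 : ℝ) →ᵇ ℝ) (t : ℝ) : |extz g t| ≤ ‖g‖ := by
  unfold extz
  split_ifs with h
  · exact g.norm_coe_le_norm ⟨t, h⟩
  · simp

lemma continuousOn_extz (g : Ioi (0 : ℝ) →ᵇ ℝ) : ContinuousOn (extz g) (Ioi 0) := by
  rw [continuousOn_iff_continuous_domRestrict]
  refine g.continuous.congr fun t => ?_
  simp [extz_of_pos g t.2]

lemma extz_add (g h : Ioi (0 : ℝ) →ᵇ ℝ) (t : ℝ) : extz (g + h) t = extz g t + extz h t := by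
  unfold extz; split_ifs <;> simp

lemma extz_smul (c : ℝ) (g : Ioi (0 : ℝ) →ᵇ ℝ) (t : ℝ) : extz (c • g) t = c * extz g t := by
  unfold extz; split_ifs <;> simp

/-- The kernel `w m³ / t²`, written so that it is continuous at `0`. -/
noncomputable def ker (k : ℕ) (t : ℝ) : ℝ := wt k t * (t * rsq k t ^ 3)

lemma ker_eq (k : ℕ) {t : ℝ} (h : 0 < t) : ker k t = wt k t * (base k t ^ 3 / t ^ 2) := by
  have := h.ne'
  unfold ker base; field_simp

lemma ker_nonneg (k : ℕ) {t : ℝ} (h : 0 < t) : 0 ≤ ker k t := by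
  have := wt_pos k h; have := rsq_pos k t
  unfold ker; positivity

lemma continuous_ker (k : ℕ) : Continuous (ker k) := by
  have := continuous_wt k; have := continuous_rsq k
  unfold ker; fun_prop

/-- The flux `∫₀ˢ w (m³/t²) g dt` of the solution of `(w y')' = w (m³/ρ²) g`. -/
noncomputable def flux (k : ℕ) (g : Ioi (0 : ℝ) →ᵇ ℝ) (s : ℝ) : ℝ :=
  ∫ t in (0 : ℝ)..s, ker k t * extz g t

lemma flux_facts (k : ℕ) (g : Ioi (0 : ℝ) →ᵇ ℝ) :
    (∀ s, 0 ≤ s → IntervalIntegrable (fun t => ker k t * extz g t) volume 0 s) ∧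
      ∀ s, 0 < s → HasDerivAt (flux k g) (ker k s * extz g s) s := by
  refine primitive_of_bounded (b := fun t => |ker k t| * ‖g‖)
    ((continuous_ker k).continuousOn.mul (continuousOn_extz g))
    ((continuous_ker k).abs.mul continuous_const) fun t _ => ?_
  rw [abs_mul]
  exact mul_le_mul_of_nonneg_left (abs_extz_le g t) (abs_nonneg _)

lemma abs_flux_le (k : ℕ) (hk : 1 ≤ k) (g : Ioi (0 : ℝ) →ᵇ ℝ) {s : ℝ} (hs : 0 ≤ s) :
    |flux k g s| ≤ ‖g‖ / (3 * k) * (wt k s * dcube k s) := by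
  have hk' : (0 : ℝ) < k := by exact_mod_cast hk
  refine abs_primitive_le (flux_facts k g).1 (flux_facts k g).2
    (B := fun s => ‖g‖ / (3 * k) * (wt k s * dcube k s))
    (continuousOn_const.mul ((continuous_wt k).mul (continuous_dcube k)).continuousOn)
    (by simp [dcube]) (fun t ht => (hasDerivAt_wt_dcube k ht).const_mul _) (fun t ht => ?_) hs
  rw [abs_mul, abs_of_nonneg (ker_nonneg k ht), ker_eq k ht]
  have h1 := wt_pos k ht
  have h2 := base_pos k ht
  calc wt k t * (base k t ^ 3 / t ^ 2) * |extz g t|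
      ≤ wt k t * (base k t ^ 3 / t ^ 2) * ‖g‖ := by gcongr; exact abs_extz_le g t
    _ = ‖g‖ / (3 * k) * (wt k t * (base k t ^ 3 * (3 * k) / t ^ 2)) := by field_simp
    _ ≤ _ := by gcongr; nlinarith [sq_nonneg (1 - base k t ^ 2), sq_nonneg (base k t ^ 2)]

/-- The solution `∫₀^ρ flux / w` of `(w y')' = w (m³/ρ²) g` with vanishing Cauchy data at `0`. -/
noncomputable def potential (k : ℕ) (g : Ioi (0 : ℝ) →ᵇ ℝ) (ρ : ℝ) : ℝ :=
  ∫ s in (0 : ℝ)..ρ, flux k g s / wt k s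

lemma abs_flux_div_le (k : ℕ) (hk : 1 ≤ k) (g : Ioi (0 : ℝ) →ᵇ ℝ) {s : ℝ} (hs : 0 < s) :
    |flux k g s / wt k s| ≤ ‖g‖ / (3 * k) * dcube k s := by
  have h := wt_pos k hs
  rw [abs_div, abs_of_pos h, div_le_iff₀ h]
  refine (abs_flux_le k hk g hs.le).trans (le_of_eq (by ring))

lemma continuousOn_flux_div (k : ℕ) (g : Ioi (0 : ℝ) →ᵇ ℝ) :
    ContinuousOn (fun s => flux k g s / wt k s) (Ioi 0) := fun s hs =>
  (((flux_facts k g).2 s hs).continuousAt.div (continuous_wt k).continuousAt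
    (wt_pos k hs).ne').continuousWithinAt

lemma potential_facts (k : ℕ) (hk : 1 ≤ k) (g : Ioi (0 : ℝ) →ᵇ ℝ) :
    (∀ s, 0 ≤ s → IntervalIntegrable (fun s => flux k g s / wt k s) volume 0 s) ∧
      ∀ s, 0 < s → HasDerivAt (potential k g) (flux k g s / wt k s) s :=
  primitive_of_bounded (b := fun s => ‖g‖ / (3 * k) * dcube k s) (continuousOn_flux_div k g)
    (continuous_const.mul (continuous_dcube k)) fun _ hs => abs_flux_div_le k hk g hs

lemma abs_potential_le (k : ℕ) (hk : 1 ≤ k) (g : Ioi (0 : ℝ) →ᵇ ℝ) {ρ : ℝ} (hρ : 0 ≤ ρ) :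
    |potential k g ρ| ≤ ‖g‖ / (3 * k) * base k ρ ^ 3 :=
  abs_primitive_le (potential_facts k hk g).1 (potential_facts k hk g).2
    (B := fun ρ => ‖g‖ / (3 * k) * base k ρ ^ 3)
    (continuousOn_const.mul ((continuous_base k).pow 3).continuousOn)
    (by simp [base_zero]) (fun t _ => (hasDerivAt_base_cube k t).const_mul _)
    (fun _ ht => abs_flux_div_le k hk g ht) hρ

lemma flux_add (k : ℕ) (g h : Ioi (0 : ℝ) →ᵇ ℝ) {s : ℝ} (hs : 0 ≤ s) :
    flux k (g + h) s = flux k g s + flux k h s := by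
  unfold flux
  rw [← intervalIntegral.integral_add ((flux_facts k g).1 s hs) ((flux_facts k h).1 s hs)]
  simp only [extz_add, mul_add]

lemma flux_smul (k : ℕ) (c : ℝ) (g : Ioi (0 : ℝ) →ᵇ ℝ) (s : ℝ) :
    flux k (c • g) s = c * flux k g s := by
  unfold flux
  rw [← intervalIntegral.integral_const_mul]
  simp only [extz_smul, mul_left_comm]

lemma potential_add (k : ℕ) (hk : 1 ≤ k) (g h : Ioi (0 : ℝ) →ᵇ ℝ) {ρ : ℝ} (hρ : 0 ≤ ρ) :
    potential k (g + h) ρ = potential k g ρ + potential k h ρ := by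
  unfold potential
  rw [← intervalIntegral.integral_add ((potential_facts k hk g).1 ρ hρ)
    ((potential_facts k hk h).1 ρ hρ)]
  refine intervalIntegral.integral_congr fun s hs => ?_
  rw [uIcc_of_le hρ] at hs
  simp only [flux_add k g h hs.1, add_div]

lemma potential_smul (k : ℕ) (c : ℝ) (g : Ioi (0 : ℝ) →ᵇ ℝ) (ρ : ℝ) :
    potential k (c • g) ρ = c * potential k g ρ := by
  unfold potential
  rw [← intervalIntegral.integral_const_mul]
  simp only [flux_smul, mul_div_assoc]

lemma norm_potential_div_le (k : ℕ) (hk : 1 ≤ k) (g : Ioi (0 : ℝ) →ᵇ ℝ) {ρ : ℝ} (hρ : 0 < ρ) :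
    ‖potential k g ρ / base k ρ ^ 3‖ ≤ ‖g‖ / (3 * k) := by
  have h := pow_pos (base_pos k hρ) 3
  rw [norm_div, Real.norm_of_nonneg h.le, div_le_iff₀ h]
  exact abs_potential_le k hk g hρ.le

/-- The operator `g ↦ m⁻³ · potential g` on bounded continuous functions on `(0, ∞)`. -/
noncomputable def solOp (k : ℕ) (hk : 1 ≤ k) : (Ioi (0 : ℝ) →ᵇ ℝ) →L[ℝ] (Ioi (0 : ℝ) →ᵇ ℝ) :=
  LinearMap.mkContinuous
    { toFun := fun g => BoundedContinuousFunction.ofNormedAddCommGroup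
        (fun ρ : Ioi (0 : ℝ) => potential k g ρ / base k ρ ^ 3)
        (continuous_iff_continuousAt.2 fun ρ =>
          ((((potential_facts k hk g).2 ρ ρ.2).continuousAt.comp
            continuous_subtype_val.continuousAt).div
            (((continuous_base k).comp continuous_subtype_val).pow 3).continuousAt
            (pow_pos (base_pos k ρ.2) 3).ne'))
        (‖g‖ / (3 * k)) (fun ρ => norm_potential_div_le k hk g ρ.2)
      map_add' := fun g h => by
        ext ρ
        simp [potential_add k hk g h (le_of_lt ρ.2), add_div]
      map_smul' := fun c g => by
        ext ρ
        simp [potential_smul k c g, mul_div_assoc] }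
    (1 / (3 * k)) (fun g => by
      refine (BoundedContinuousFunction.norm_le (by positivity)).2 fun ρ => ?_
      refine (norm_potential_div_le k hk g ρ.2).trans ?_
      exact le_of_eq (by ring))

lemma solOp_apply (k : ℕ) (hk : 1 ≤ k) (g : Ioi (0 : ℝ) →ᵇ ℝ) (ρ : Ioi (0 : ℝ)) :
    solOp k hk g ρ = potential k g ρ / base k ρ ^ 3 := rfl

lemma norm_solOp_le (k : ℕ) (hk : 1 ≤ k) : ‖solOp k hk‖ ≤ 1 / (3 * k) :=
  LinearMap.mkContinuous_norm_le _ (by positivity) _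

lemma integrableOn_dcube (k : ℕ) : IntegrableOn (dcube k) (Ioi 0) :=
  integrableOn_Ioi_deriv_of_nonneg' (fun x _ => hasDerivAt_base_cube k x)
    (fun x _ => dcube_nonneg k x) ((tendsto_base_atTop k).pow 3)

lemma integrableOn_flux_div (k : ℕ) (hk : 1 ≤ k) (g : Ioi (0 : ℝ) →ᵇ ℝ) :
    IntegrableOn (fun s => flux k g s / wt k s) (Ioi 0) :=
  ((integrableOn_dcube k).const_mul (‖g‖ / (3 * k))).mono'
    ((continuousOn_flux_div k g).aestronglyMeasurable measurableSet_Ioi)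
    ((ae_restrict_mem measurableSet_Ioi).mono fun _ hs => abs_flux_div_le k hk g hs)

/-- The value at infinity of `potential g`, as a continuous linear functional of `g`. -/
noncomputable def limOp (k : ℕ) (hk : 1 ≤ k) : (Ioi (0 : ℝ) →ᵇ ℝ) →L[ℝ] ℝ :=
  LinearMap.mkContinuous
    { toFun := fun g => ∫ s in Ioi (0 : ℝ), flux k g s / wt k s
      map_add' := fun g h => by
        rw [← integral_add (integrableOn_flux_div k hk g) (integrableOn_flux_div k hk h)]
        refine setIntegral_congr_fun measurableSet_Ioi fun s hs => ?_
        simp only [flux_add k g h (le_of_lt hs), add_div]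
      map_smul' := fun c g => by
        simp only [flux_smul, mul_div_assoc, integral_const_mul, RingHom.id_apply, smul_eq_mul] }
    ((∫ s in Ioi (0 : ℝ), dcube k s) / (3 * k)) (fun g => by
      refine (norm_integral_le_of_norm_le ((integrableOn_dcube k).const_mul (‖g‖ / (3 * k)))
        ((ae_restrict_mem measurableSet_Ioi).mono fun _ hs => abs_flux_div_le k hk g hs)).trans ?_
      rw [integral_const_mul]
      exact le_of_eq (by ring))

lemma tendsto_potential (k : ℕ) (hk : 1 ≤ k) (g : Ioi (0 : ℝ) →ᵇ ℝ) :
    Tendsto (potential k g) atTop (𝓝 (limOp k hk g)) :=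
  intervalIntegral_tendsto_integral_Ioi 0 (integrableOn_flux_div k hk g) tendsto_id

/-! ### The fixed-point equation and its analytic dependence on the slope -/

/-- Taylor coefficients of `z ↦ (sin √z - √z) / z^{3/2}`. -/
noncomputable def sinRemCoeff (n : ℕ) : ℝ := (-1) ^ (n + 1) / ((2 * n + 3).factorial : ℝ)

/-- The entire function `S` with `sin x = x + x³ S(x²)`, in a real Banach algebra. -/
noncomputable def sinRem {E : Type*} [NormedCommRing E] [NormedAlgebra ℝ E] : E → E :=
  FormalMultilinearSeries.ofScalarsSum sinRemCoeff

lemma sinRem_radius (E : Type*) [NormedCommRing E] [NormedAlgebra ℝ E] :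
    (FormalMultilinearSeries.ofScalars E sinRemCoeff).radius = ⊤ := by
  refine FormalMultilinearSeries.ofScalars_radius_eq_top_of_tendsto _ _
    (Eventually.of_forall fun n => ?_) ?_
  · unfold sinRemCoeff; positivity
  · have h : ∀ n : ℕ, ‖sinRemCoeff n.succ‖ / ‖sinRemCoeff n‖
        = 1 / ((2 * (n : ℝ) + 5) * (2 * n + 4)) := by
      intro n
      unfold sinRemCoeff
      have e : 2 * n.succ + 3 = (2 * n + 3 + 1) + 1 := by omega
      rw [e, Nat.factorial_succ, Nat.factorial_succ]
      simp only [norm_div, norm_pow, norm_neg, norm_one, one_pow, RCLike.norm_natCast]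
      have : ((2 * n + 3).factorial : ℝ) ≠ 0 := by positivity
      push_cast
      field_simp
      ring
    simp only [h]
    refine squeeze_zero (fun n => by positivity) (fun n => ?_) tendsto_one_div_add_atTop_nhds_zero_nat
    gcongr
    nlinarith [(Nat.cast_nonneg n : (0 : ℝ) ≤ n)]

lemma sinRem_hasFPowerSeries (E : Type*) [NormedCommRing E] [NormedAlgebra ℝ E] [CompleteSpace E] :
    HasFPowerSeriesOnBall (sinRem : E → E)
      (FormalMultilinearSeries.ofScalars E sinRemCoeff) 0 ⊤ := by
  have h := (FormalMultilinearSeries.ofScalars E sinRemCoeff).hasFPowerSeriesOnBall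
    (by rw [sinRem_radius]; exact ENNReal.zero_lt_top)
  rwa [sinRem_radius] at h

lemma contDiff_sinRem (E : Type*) [NormedCommRing E] [NormedAlgebra ℝ E] [CompleteSpace E] :
    ContDiff ℝ ω (sinRem : E → E) := by
  rw [contDiff_omega_iff_analyticOnNhd]
  intro x _
  exact (sinRem_hasFPowerSeries E).analyticAt_of_mem (by simp)

lemma hasSum_sinRem {E : Type*} [NormedCommRing E] [NormedAlgebra ℝ E] [CompleteSpace E] (x : E) :
    HasSum (fun n => sinRemCoeff n • x ^ n) (sinRem x) := by
  have h := (sinRem_hasFPowerSeries E).hasSum (y := x) (by simp)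
  simpa [FormalMultilinearSeries.ofScalars_apply_eq] using h

lemma sin_eq_add_sinRem (x : ℝ) : Real.sin x = x + x ^ 3 * sinRem (x ^ 2) := by
  have h1 := (hasSum_sinRem (x ^ 2)).mul_left (x ^ 3)
  have h2 := Real.hasSum_sin x
  have h3 := (hasSum_nat_add_iff' (f := fun n : ℕ =>
    (-1) ^ n * x ^ (2 * n + 1) / ((2 * n + 1).factorial : ℝ)) 1).2 h2
  have h4 := h1.unique (h3.congr_fun ?_)
  · simp at h4; linarith
  · intro n
    simp only [sinRemCoeff, smul_eq_mul]
    have e : 2 * (n + 1) + 1 = 2 * n + 3 := by ring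
    rw [e]
    ring

lemma sinRem_apply (f : Ioi (0 : ℝ) →ᵇ ℝ) (t : Ioi (0 : ℝ)) : sinRem f t = sinRem (f t) := by
  have h := (hasSum_sinRem f).mapL (BoundedContinuousFunction.evalCLM ℝ t)
  refine h.unique ?_
  refine (hasSum_sinRem (f t)).congr_fun fun n => ?_
  simp

/-- The function `m` as an element of the Banach algebra of bounded continuous functions. -/
noncomputable def baseB (k : ℕ) : Ioi (0 : ℝ) →ᵇ ℝ :=
  BoundedContinuousFunction.ofNormedAddCommGroup (fun ρ : Ioi (0 : ℝ) => base k ρ)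
    ((continuous_base k).comp continuous_subtype_val) 1 (fun ρ => by
      rw [Real.norm_of_nonneg (base_pos k ρ.2).le]; exact (base_lt_one k ρ).le)

lemma baseB_apply (k : ℕ) (ρ : Ioi (0 : ℝ)) : baseB k ρ = base k ρ := rfl

/-- The nonlinearity in the variable `v`, where `ψ = β m + m³ v`: the bounded function
`m⁻³ ((k/2) sin 2ψ - β ρ² (w m')'/w)`, written without division. -/
noncomputable def nem (k : ℕ) (p : ℝ × (Ioi (0 : ℝ) →ᵇ ℝ)) : Ioi (0 : ℝ) →ᵇ ℝ :=
  (k : ℝ) • (p.2 + (4 : ℝ) • ((p.1 • 1 + baseB k ^ 2 * p.2) ^ 3 *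
    sinRem ((4 : ℝ) • (baseB k * (p.1 • 1 + baseB k ^ 2 * p.2)) ^ 2)))
    - (3 * p.1) • baseB k ^ 2

lemma contDiff_nem (k : ℕ) : ContDiff ℝ ω (nem k) := by
  have h := contDiff_sinRem (Ioi (0 : ℝ) →ᵇ ℝ)
  unfold nem
  fun_prop

lemma base_cube_mul_nem (k : ℕ) (β : ℝ) (v : Ioi (0 : ℝ) →ᵇ ℝ) (ρ : Ioi (0 : ℝ)) :
    base k ρ ^ 3 * nem k (β, v) ρ =
      k / 2 * Real.sin (2 * (β * base k ρ + base k ρ ^ 3 * v ρ))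
        - β * (base k ρ * (k + 3 * base k ρ ^ 4)) := by
  rw [sin_eq_add_sinRem]
  simp only [nem, BoundedContinuousFunction.coe_sub, BoundedContinuousFunction.coe_smul,
    BoundedContinuousFunction.coe_add, BoundedContinuousFunction.coe_mul,
    BoundedContinuousFunction.coe_pow, Pi.sub_apply, Pi.add_apply, Pi.mul_apply, Pi.pow_apply,
    BoundedContinuousFunction.coe_one, Pi.one_apply, smul_eq_mul, sinRem_apply, baseB_apply]
  have e : 4 * (base k ρ * (β * 1 + base k ρ ^ 2 * v ρ)) ^ 2
      = (2 * (β * base k ρ + base k ρ ^ 3 * v ρ)) ^ 2 := by ring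
  rw [e]
  ring

lemma norm_nem_sub_le (k : ℕ) (β : ℝ) (u v : Ioi (0 : ℝ) →ᵇ ℝ) :
    ‖nem k (β, u) - nem k (β, v)‖ ≤ k * ‖u - v‖ := by
  refine (BoundedContinuousFunction.norm_le (by positivity)).2 fun ρ => ?_
  have h := pow_pos (base_pos k ρ.2) 3
  rw [← mul_le_mul_iff_right₀ h]
  have h1 := base_cube_mul_nem k β u ρ
  have h2 := base_cube_mul_nem k β v ρ
  have hL : |Real.sin (2 * (β * base k ρ + base k ρ ^ 3 * u ρ))
      - Real.sin (2 * (β * base k ρ + base k ρ ^ 3 * v ρ))| ≤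
      |2 * (β * base k ρ + base k ρ ^ 3 * u ρ) - 2 * (β * base k ρ + base k ρ ^ 3 * v ρ)| := by
    simpa [Real.dist_eq] using Real.lipschitzWith_sin.dist_le_mul
      (2 * (β * base k ρ + base k ρ ^ 3 * u ρ)) (2 * (β * base k ρ + base k ρ ^ 3 * v ρ))
  have h3 : |u ρ - v ρ| ≤ ‖u - v‖ := (u - v).norm_coe_le_norm ρ
  calc base k ρ ^ 3 * ‖(nem k (β, u) - nem k (β, v)) ρ‖
      = |base k ρ ^ 3 * nem k (β, u) ρ - base k ρ ^ 3 * nem k (β, v) ρ| := by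
        rw [← mul_sub, abs_mul, abs_of_pos h]; rfl
    _ = k / 2 * |Real.sin (2 * (β * base k ρ + base k ρ ^ 3 * u ρ))
      - Real.sin (2 * (β * base k ρ + base k ρ ^ 3 * v ρ))| := by
        rw [h1, h2, sub_sub_sub_cancel_right, ← mul_sub, abs_mul, abs_of_nonneg (by positivity)]
    _ ≤ k / 2 * (2 * (base k ρ ^ 3 * ‖u - v‖)) := by
        gcongr
        refine hL.trans ?_
        rw [← mul_sub, abs_mul, abs_two, add_sub_add_left_eq_sub, ← mul_sub, abs_mul,
          abs_of_pos h]
        gcongr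
    _ = _ := by ring

/-- The contraction whose fixed point is the profile with slope parameter `β`. -/
noncomputable def picard (k : ℕ) (hk : 1 ≤ k) (p : ℝ × (Ioi (0 : ℝ) →ᵇ ℝ)) : Ioi (0 : ℝ) →ᵇ ℝ :=
  solOp k hk (nem k p)

lemma contDiff_picard (k : ℕ) (hk : 1 ≤ k) : ContDiff ℝ ω (picard k hk) :=
  (solOp k hk).contDiff.comp (contDiff_nem k)

lemma lipschitz_picard (k : ℕ) (hk : 1 ≤ k) (β : ℝ) :
    LipschitzWith (1 / 3) fun v => picard k hk (β, v) := by
  refine LipschitzWith.of_dist_le_mul fun u v => ?_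
  have hk' : (0 : ℝ) < k := by exact_mod_cast hk
  rw [dist_eq_norm, dist_eq_norm]
  simp only [picard]
  rw [← map_sub]
  calc _ ≤ 1 / (3 * k) * (k * ‖u - v‖) :=
        (solOp k hk).le_of_opNorm_le_of_le (norm_solOp_le k hk) (norm_nem_sub_le k β u v)
    _ = 1 / 3 * ‖u - v‖ := by field_simp
    _ = _ := by simp

lemma contracting_picard (k : ℕ) (hk : 1 ≤ k) (β : ℝ) :
    ContractingWith (1 / 3) fun v => picard k hk (β, v) :=
  ⟨by rw [← NNReal.coe_lt_coe]; norm_num, lipschitz_picard k hk β⟩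

/-- The fixed point of `picard` at parameter `β`. -/
noncomputable def fixpt (k : ℕ) (hk : 1 ≤ k) (β : ℝ) : Ioi (0 : ℝ) →ᵇ ℝ :=
  (contracting_picard k hk β).fixedPoint

lemma picard_fixpt (k : ℕ) (hk : 1 ≤ k) (β : ℝ) : picard k hk (β, fixpt k hk β) = fixpt k hk β :=
  (contracting_picard k hk β).fixedPoint_isFixedPt

/-- The fixed point depends analytically on the parameter, by the implicit function theorem. -/
lemma contDiff_fixpt (k : ℕ) (hk : 1 ≤ k) : ContDiff ℝ ω (fixpt k hk) := by
  rw [contDiff_iff_contDiffAt]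
  intro β
  have hf : ContDiff ℝ ω fun p : ℝ × (Ioi (0 : ℝ) →ᵇ ℝ) => p.2 - picard k hk p :=
    contDiff_snd.sub (contDiff_picard k hk)
  have hinv : (fderiv ℝ (fun p : ℝ × (Ioi (0 : ℝ) →ᵇ ℝ) => p.2 - picard k hk p)
      (β, fixpt k hk β) ∘L .inr ℝ ℝ (Ioi (0 : ℝ) →ᵇ ℝ)).IsInvertible := by
    have hp : DifferentiableAt ℝ (picard k hk) (β, fixpt k hk β) :=
      (contDiff_picard k hk).differentiable (by simp) _
    -- the partial derivative in `v` has norm at most `1/3`, so `1 - T` is inverted by a Neumann series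
    set T := fderiv ℝ (picard k hk) (β, fixpt k hk β) ∘L .inr ℝ ℝ (Ioi (0 : ℝ) →ᵇ ℝ) with hT
    have h1 : HasFDerivAt (fun v => picard k hk (β, v)) T (fixpt k hk β) :=
      hp.hasFDerivAt.comp (fixpt k hk β) (hasFDerivAt_prodMk_right β (fixpt k hk β))
    have h2 : ‖T‖ < 1 :=
      (h1.le_of_lipschitz (lipschitz_picard k hk β)).trans_lt (by norm_num)
    have h3 : fderiv ℝ (fun p : ℝ × (Ioi (0 : ℝ) →ᵇ ℝ) => p.2 - picard k hk p)
        (β, fixpt k hk β) ∘L .inr ℝ ℝ (Ioi (0 : ℝ) →ᵇ ℝ) = 1 - T := by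
      rw [fderiv_fun_sub differentiableAt_snd hp]
      ext v
      simp [hT, fderiv_snd]
    rw [h3]
    exact ⟨ContinuousLinearEquiv.unitsEquiv ℝ _ (Units.oneSub T h2), by ext; simp⟩
  have hcd := hf.contDiffAt (x := (β, fixpt k hk β))
  refine (hcd.contDiffAt_implicitFunction (by simp) hinv).congr_of_eventuallyEq ?_
  filter_upwards [hcd.eventually_apply_implicitFunction (by simp) hinv] with x hx
  rw [picard_fixpt, sub_self, sub_eq_zero] at hx
  exact ((contracting_picard k hk x).fixedPoint_unique hx.symm).symm

/-! ### The analytic family of profiles and its variation -/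

/-- The expander equation as a first-order system for `a = ψ` and `b = ρ ψ'`, together with the
initial slope `α` at `ρ = 0`. -/
structure IsFlow (k : ℕ) (α : ℝ) (a b : ℝ → ℝ) : Prop where
  da : ∀ ρ, 0 < ρ → HasDerivAt a (b ρ / ρ) ρ
  db : ∀ ρ, 0 < ρ →
    HasDerivAt b ((-(k - 1 + ρ ^ 2 / 2) * b ρ + k / 2 * Real.sin (2 * a ρ)) / ρ) ρ
  ta : Tendsto (fun ρ => a ρ / ρ) (𝓝[>] 0) (𝓝 α)
  tb : Tendsto (fun ρ => b ρ / ρ) (𝓝[>] 0) (𝓝 α)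

/-- The linearisation of the expander equation along `a`, as a first-order system for `p = φ` and
`q = ρ φ'`, with unit slope at `ρ = 0`. -/
structure IsVariation (k : ℕ) (a p q : ℝ → ℝ) : Prop where
  dp : ∀ ρ, 0 < ρ → HasDerivAt p (q ρ / ρ) ρ
  dq : ∀ ρ, 0 < ρ →
    HasDerivAt q ((-(k - 1 + ρ ^ 2 / 2) * q ρ + k * Real.cos (2 * a ρ) * p ρ) / ρ) ρ
  tp : Tendsto (fun ρ => p ρ / ρ) (𝓝[>] 0) (𝓝 1)
  tq : Tendsto (fun ρ => q ρ / ρ) (𝓝[>] 0) (𝓝 1)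

/-- The function `β m + potential g`. -/
noncomputable def ansatz (k : ℕ) (β : ℝ) (g : Ioi (0 : ℝ) →ᵇ ℝ) (ρ : ℝ) : ℝ :=
  β * base k ρ + potential k g ρ

/-- The derivative of `ansatz`. -/
noncomputable def dansatz (k : ℕ) (β : ℝ) (g : Ioi (0 : ℝ) →ᵇ ℝ) (ρ : ℝ) : ℝ :=
  β * ((2 * k + 6) * rsq k ρ ^ 3) + flux k g ρ / wt k ρ

lemma hasDerivAt_ansatz {k : ℕ} (hk : 1 ≤ k) (β : ℝ) (g : Ioi (0 : ℝ) →ᵇ ℝ) {ρ : ℝ} (h : 0 < ρ) :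
    HasDerivAt (ansatz k β g) (dansatz k β g ρ) ρ :=
  ((hasDerivAt_base k ρ).const_mul β).add ((potential_facts k hk g).2 ρ h)

lemma hasDerivAt_mul_dansatz {k : ℕ} (β : ℝ) (g : Ioi (0 : ℝ) →ᵇ ℝ) {ρ : ℝ} (h : 0 < ρ) {S : ℝ}
    (hS : β * (base k ρ * (k + 3 * base k ρ ^ 4)) + base k ρ ^ 3 * g ⟨ρ, h⟩ = S) :
    HasDerivAt (fun ρ => ρ * dansatz k β g ρ)
      ((-(k - 1 + ρ ^ 2 / 2) * (ρ * dansatz k β g ρ) + S) / ρ) ρ := by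
  have hw := wt_pos k h
  have h1 := ((hasDerivAt_id ρ).mul (((hasDerivAt_wt_dbase k h).const_mul β).add
    ((flux_facts k g).2 ρ h))).div (hasDerivAt_wt k h) hw.ne'
  have h2 := h1.congr_of_eventuallyEq (f₁ := fun ρ => ρ * dansatz k β g ρ) (by
    filter_upwards [Ioi_mem_nhds h] with s hs
    have := (wt_pos k hs).ne'
    simp only [dansatz, Pi.add_apply, Pi.mul_apply, Pi.div_apply, id]
    field_simp)
  refine h2.congr_deriv ?_
  rw [← hS, ker_eq k h, extz_of_pos g h]
  simp only [dansatz, Pi.add_apply, Pi.mul_apply, id]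
  have := h.ne'
  field_simp
  ring

lemma tendsto_ansatz_div {k : ℕ} (hk : 1 ≤ k) (β : ℝ) (g : Ioi (0 : ℝ) →ᵇ ℝ) : Tendsto (fun ρ => ansatz k β g ρ / ρ) (𝓝[>] 0) (𝓝 (β * rsq k 0)) := by
  have h1 : Tendsto (fun ρ => β * rsq k ρ) (𝓝[>] 0) (𝓝 (β * rsq k 0)) :=
    ((continuous_const.mul (continuous_rsq k)).tendsto 0).mono_left nhdsWithin_le_nhds
  have h2 : Tendsto (fun ρ => potential k g ρ / ρ) (𝓝[>] 0) (𝓝 0) := by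
    have h3 : Tendsto (fun ρ => ‖g‖ / (3 * k) * (ρ ^ 2 * rsq k ρ ^ 3)) (𝓝[>] 0) (𝓝 0) := by
      have := continuous_rsq k
      have h4 : Continuous fun ρ => ‖g‖ / (3 * k) * (ρ ^ 2 * rsq k ρ ^ 3) := by fun_prop
      simpa using (h4.tendsto 0).mono_left nhdsWithin_le_nhds
    refine squeeze_zero_norm' ?_ h3
    filter_upwards [self_mem_nhdsWithin] with ρ hρ
    have hρ : 0 < ρ := hρ
    rw [norm_div, Real.norm_of_nonneg hρ.le, div_le_iff₀ hρ]
    refine (abs_potential_le k hk g hρ.le).trans (le_of_eq ?_)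
    unfold base; ring
  have h5 := h1.add h2
  rw [add_zero] at h5
  refine h5.congr' ?_
  filter_upwards [self_mem_nhdsWithin] with ρ hρ
  have hρ : ρ ≠ 0 := ne_of_gt hρ
  unfold ansatz base
  field_simp

lemma tendsto_dansatz {k : ℕ} (hk : 1 ≤ k) (β : ℝ) (g : Ioi (0 : ℝ) →ᵇ ℝ) : Tendsto (fun ρ => ρ * dansatz k β g ρ / ρ) (𝓝[>] 0)
    (𝓝 (β * rsq k 0)) := by
  have h1 : Tendsto (fun ρ => β * ((2 * (k : ℝ) + 6) * rsq k ρ ^ 3)) (𝓝[>] 0)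
      (𝓝 (β * ((2 * (k : ℝ) + 6) * rsq k 0 ^ 3))) := by
    have := continuous_rsq k
    have h4 : Continuous fun ρ => β * ((2 * (k : ℝ) + 6) * rsq k ρ ^ 3) := by fun_prop
    exact (h4.tendsto 0).mono_left nhdsWithin_le_nhds
  have h2 : Tendsto (fun ρ => flux k g ρ / wt k ρ) (𝓝[>] 0) (𝓝 0) := by
    have h3 : Tendsto (fun ρ => ‖g‖ / (3 * k) * dcube k ρ) (𝓝[>] 0) (𝓝 0) := by
      have h4 : Continuous fun ρ => ‖g‖ / (3 * k) * dcube k ρ :=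
        continuous_const.mul (continuous_dcube k)
      simpa [dcube] using (h4.tendsto 0).mono_left nhdsWithin_le_nhds
    refine squeeze_zero_norm' ?_ h3
    filter_upwards [self_mem_nhdsWithin] with ρ hρ
    exact abs_flux_div_le k hk g hρ
  have h5 := h1.add h2
  have h6 := rsq_sq k 0
  have h7 : β * ((2 * (k : ℝ) + 6) * rsq k 0 ^ 3) + 0 = β * rsq k 0 := by
    linear_combination (β * rsq k 0) * h6
  rw [h7] at h5
  refine h5.congr' ?_
  filter_upwards [self_mem_nhdsWithin] with ρ hρ
  have hρ : ρ ≠ 0 := ne_of_gt hρ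
  unfold dansatz
  field_simp

lemma tendsto_ansatz_atTop {k : ℕ} (hk : 1 ≤ k) (β : ℝ) (g : Ioi (0 : ℝ) →ᵇ ℝ) : Tendsto (ansatz k β g) atTop (𝓝 (β + limOp k hk g)) := by
  have h := ((tendsto_base_atTop k).const_mul β).add (tendsto_potential k hk g)
  rwa [mul_one] at h

lemma ansatz_zero (k : ℕ) (β : ℝ) (g : Ioi (0 : ℝ) →ᵇ ℝ) : ansatz k β g 0 = 0 := by simp [ansatz, base_zero, potential]

lemma ansatz_eq {k : ℕ} (hk : 1 ≤ k) (β : ℝ) (g : Ioi (0 : ℝ) →ᵇ ℝ) (ρ : Ioi (0 : ℝ)) :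
    ansatz k β g ρ = β * base k ρ + base k ρ ^ 3 * solOp k hk g ρ := by
  have := (pow_pos (base_pos k ρ.2) 3).ne'
  rw [solOp_apply, ansatz, mul_div_cancel₀ _ this]

/-- The reciprocal of the slope of `m` at the origin, so that `slopeUnit k • m` has unit slope. -/
noncomputable def slopeUnit (k : ℕ) : ℝ := (rsq k 0)⁻¹

lemma slopeUnit_mul (k : ℕ) : slopeUnit k * rsq k 0 = 1 := inv_mul_cancel₀ (rsq_pos k 0).ne'

/-- The source term of the profile with slope `α`. -/
noncomputable def source (k : ℕ) (hk : 1 ≤ k) (α : ℝ) : Ioi (0 : ℝ) →ᵇ ℝ :=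
  nem k (α * slopeUnit k, fixpt k hk (α * slopeUnit k))

/-- The profile with slope `α`. -/
noncomputable def prof (k : ℕ) (hk : 1 ≤ k) (α : ℝ) : ℝ → ℝ :=
  ansatz k (α * slopeUnit k) (source k hk α)

/-- `ρ` times the derivative of the profile. -/
noncomputable def profD (k : ℕ) (hk : 1 ≤ k) (α ρ : ℝ) : ℝ :=
  ρ * dansatz k (α * slopeUnit k) (source k hk α) ρ

/-- The derivative of the profile with respect to the slope. -/
noncomputable def var (k : ℕ) (hk : 1 ≤ k) (α : ℝ) : ℝ → ℝ :=
  ansatz k (slopeUnit k) (deriv (source k hk) α)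

/-- `ρ` times the radial derivative of `var`. -/
noncomputable def varD (k : ℕ) (hk : 1 ≤ k) (α ρ : ℝ) : ℝ :=
  ρ * dansatz k (slopeUnit k) (deriv (source k hk) α) ρ

/-- The value of the profile at infinity. -/
noncomputable def profLim (k : ℕ) (hk : 1 ≤ k) (α : ℝ) : ℝ :=
  α * slopeUnit k + limOp k hk (source k hk α)

/-- The value of `var` at infinity. -/
noncomputable def varLim (k : ℕ) (hk : 1 ≤ k) (α : ℝ) : ℝ :=
  slopeUnit k + limOp k hk (deriv (source k hk) α)

lemma contDiff_source (k : ℕ) (hk : 1 ≤ k) : ContDiff ℝ ω (source k hk) := by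
  have h1 := contDiff_nem k
  have h2 := contDiff_fixpt k hk
  have h3 : ContDiff ℝ ω fun α : ℝ => α * slopeUnit k := by fun_prop
  exact h1.comp (h3.prodMk (h2.comp h3))

lemma hasDerivAt_source (k : ℕ) (hk : 1 ≤ k) (α : ℝ) : HasDerivAt (source k hk) (deriv (source k hk) α) α :=
  ((contDiff_source k hk).differentiable (by simp) α).hasDerivAt

lemma solOp_source (k : ℕ) (hk : 1 ≤ k) (α : ℝ) : solOp k hk (source k hk α) = fixpt k hk (α * slopeUnit k) :=
  picard_fixpt k hk (α * slopeUnit k)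

lemma contDiff_deriv_source (k : ℕ) (hk : 1 ≤ k) : ContDiff ℝ ω (deriv (source k hk)) :=
  ((contDiff_succ_iff_deriv (n := ω)).1 (contDiff_source k hk)).2.2

lemma prof_zero (k : ℕ) (hk : 1 ≤ k) (α : ℝ) : prof k hk α 0 = 0 := ansatz_zero _ _ _

lemma var_zero (k : ℕ) (hk : 1 ≤ k) (α : ℝ) : var k hk α 0 = 0 := ansatz_zero _ _ _

lemma source_apply (k : ℕ) (hk : 1 ≤ k) (α : ℝ) (ρ : Ioi (0 : ℝ)) :
    base k ρ ^ 3 * source k hk α ρ = k / 2 * Real.sin (2 * prof k hk α ρ)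
      - α * slopeUnit k * (base k ρ * (k + 3 * base k ρ ^ 4)) := by
  rw [source, base_cube_mul_nem, prof, ansatz_eq hk, solOp_source]

lemma hasDerivAt_prof_param (k : ℕ) (hk : 1 ≤ k) (α : ℝ) {ρ : ℝ} (hρ : 0 ≤ ρ) :
    HasDerivAt (fun α => prof k hk α ρ) (var k hk α ρ) α := by
  rcases hρ.eq_or_lt with rfl | hρ
  · simp only [prof_zero, var_zero]
    exact hasDerivAt_const _ _
  · have h1 := ((BoundedContinuousFunction.evalCLM ℝ (⟨ρ, hρ⟩ : Ioi (0 : ℝ))).comp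
      (solOp k hk)).hasFDerivAt.comp_hasDerivAt α (hasDerivAt_source k hk α)
    have h2 := (((hasDerivAt_id α).mul_const (slopeUnit k)).mul_const (base k ρ)).add
      (h1.const_mul (base k ρ ^ 3))
    refine (h2.congr_deriv ?_).congr_of_eventuallyEq (Eventually.of_forall fun a => ?_)
    · have := ansatz_eq hk (slopeUnit k) (deriv (source k hk) α) ⟨ρ, hρ⟩
      simp only [var, this]
      simp
    · exact ansatz_eq hk (a * slopeUnit k) (source k hk a) ⟨ρ, hρ⟩

lemma deriv_source_apply (k : ℕ) (hk : 1 ≤ k) (α : ℝ) (ρ : Ioi (0 : ℝ)) :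
    base k ρ ^ 3 * deriv (source k hk) α ρ = k * Real.cos (2 * prof k hk α ρ) * var k hk α ρ
      - slopeUnit k * (base k ρ * (k + 3 * base k ρ ^ 4)) := by
  have h1 := ((BoundedContinuousFunction.evalCLM ℝ ρ).hasFDerivAt.comp_hasDerivAt α
    (hasDerivAt_source k hk α)).const_mul (base k ρ ^ 3)
  have h2 := ((((hasDerivAt_prof_param k hk α (le_of_lt ρ.2)).const_mul 2).sin).const_mul
    ((k : ℝ) / 2)).sub
    (((hasDerivAt_id α).mul_const (slopeUnit k)).mul_const (base k ρ * (k + 3 * base k ρ ^ 4)))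
  have h3 := (h1.congr_of_eventuallyEq (Eventually.of_forall fun a =>
    (source_apply k hk a ρ).symm)).unique h2
  simp only [BoundedContinuousFunction.evalCLM_apply] at h3
  rw [h3]
  ring

lemma isFlow_prof (k : ℕ) (hk : 1 ≤ k) (α : ℝ) : IsFlow k α (prof k hk α) (profD k hk α) where
  da ρ h := (hasDerivAt_ansatz hk _ _ h).congr_deriv (by
    unfold profD; field_simp)
  db ρ h := hasDerivAt_mul_dansatz _ _ h (by
    have := source_apply k hk α ⟨ρ, h⟩
    simp only at this
    linarith)
  ta := by
    have := tendsto_ansatz_div hk (α * slopeUnit k) (source k hk α)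
    rwa [mul_assoc, slopeUnit_mul, mul_one] at this
  tb := by
    have := tendsto_dansatz hk (α * slopeUnit k) (source k hk α)
    rwa [mul_assoc, slopeUnit_mul, mul_one] at this

lemma isVariation_var (k : ℕ) (hk : 1 ≤ k) (α : ℝ) :
    IsVariation k (prof k hk α) (var k hk α) (varD k hk α) where
  dp ρ h := (hasDerivAt_ansatz hk _ _ h).congr_deriv (by
    unfold varD; field_simp)
  dq ρ h := hasDerivAt_mul_dansatz _ _ h (by
    have := deriv_source_apply k hk α ⟨ρ, h⟩
    simp only at this
    linarith)
  tp := by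
    have := tendsto_ansatz_div hk (slopeUnit k) (deriv (source k hk) α)
    rwa [slopeUnit_mul] at this
  tq := by
    have := tendsto_dansatz hk (slopeUnit k) (deriv (source k hk) α)
    rwa [slopeUnit_mul] at this

lemma tendsto_prof (k : ℕ) (hk : 1 ≤ k) (α : ℝ) : Tendsto (prof k hk α) atTop (𝓝 (profLim k hk α)) :=
  tendsto_ansatz_atTop hk _ _

lemma tendsto_var (k : ℕ) (hk : 1 ≤ k) (α : ℝ) : Tendsto (var k hk α) atTop (𝓝 (varLim k hk α)) :=
  tendsto_ansatz_atTop hk _ _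

lemma hasDerivAt_profLim (k : ℕ) (hk : 1 ≤ k) (α : ℝ) : HasDerivAt (profLim k hk) (varLim k hk α) α := by
  have h := ((hasDerivAt_id α).mul_const (slopeUnit k)).add
    ((limOp k hk).hasFDerivAt.comp_hasDerivAt α (hasDerivAt_source k hk α))
  exact h.congr_deriv (by simp [varLim])

lemma analyticOnNhd_varLim (k : ℕ) (hk : 1 ≤ k) : AnalyticOnNhd ℝ (varLim k hk) univ := by
  rw [← contDiff_omega_iff_analyticOnNhd]
  exact contDiff_const.add ((limOp k hk).contDiff.comp (contDiff_deriv_source k hk))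

lemma eventually_prof_close (k : ℕ) (hk : 1 ≤ k) (α : ℝ) {ε : ℝ} (hε : 0 < ε) :
    ∀ᶠ a in 𝓝 α, ∀ ρ, 0 ≤ ρ → |prof k hk a ρ - prof k hk α ρ| < ε := by
  have hc1 : Continuous fun a : ℝ => |a * slopeUnit k - α * slopeUnit k| := by fun_prop
  have hc2 : Continuous fun a : ℝ => ‖solOp k hk (source k hk a) - solOp k hk (source k hk α)‖ :=
    (((solOp k hk).continuous.comp (contDiff_source k hk).continuous).sub continuous_const).norm
  have h : Tendsto (fun a => |a * slopeUnit k - α * slopeUnit k|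
      + ‖solOp k hk (source k hk a) - solOp k hk (source k hk α)‖) (𝓝 α) (𝓝 0) := by
    simpa using (hc1.tendsto α).add (hc2.tendsto α)
  filter_upwards [h.eventually (gt_mem_nhds hε)] with a ha ρ hρ
  rcases hρ.eq_or_lt with rfl | hρ
  · simpa [prof_zero] using hε
  · refine lt_of_le_of_lt ?_ ha
    have e1 := ansatz_eq hk (a * slopeUnit k) (source k hk a) ⟨ρ, hρ⟩
    have e2 := ansatz_eq hk (α * slopeUnit k) (source k hk α) ⟨ρ, hρ⟩
    simp only at e1 e2
    rw [prof, prof, e1, e2]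
    have hb := base_pos k hρ
    have hb1 := (base_lt_one k ρ).le
    have h3 := (solOp k hk (source k hk a) - solOp k hk (source k hk α)).norm_coe_le_norm ⟨ρ, hρ⟩
    simp only [BoundedContinuousFunction.coe_sub, Pi.sub_apply, Real.norm_eq_abs] at h3
    calc _ = |(a * slopeUnit k - α * slopeUnit k) * base k ρ + base k ρ ^ 3 *
          (solOp k hk (source k hk a) ⟨ρ, hρ⟩ - solOp k hk (source k hk α) ⟨ρ, hρ⟩)| := by
          congr 1; ring
      _ ≤ |a * slopeUnit k - α * slopeUnit k| * base k ρ + base k ρ ^ 3 *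
          |solOp k hk (source k hk a) ⟨ρ, hρ⟩ - solOp k hk (source k hk α) ⟨ρ, hρ⟩| := by
          refine (abs_add_le _ _).trans ?_
          rw [abs_mul, abs_mul, abs_of_pos hb, abs_of_pos (pow_pos hb 3)]
      _ ≤ |a * slopeUnit k - α * slopeUnit k| * 1
          + 1 * ‖solOp k hk (source k hk a) - solOp k hk (source k hk α)‖ := by
          gcongr
          exact pow_le_one₀ hb.le hb1
      _ = _ := by rw [mul_one, one_mul]

lemma eventually_var_close (k : ℕ) (hk : 1 ≤ k) (α : ℝ) {ε : ℝ} (hε : 0 < ε) :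
    ∀ᶠ a in 𝓝 α, ∀ ρ, 0 < ρ → |var k hk a ρ - var k hk α ρ| < ε * base k ρ := by
  have hc2 : Continuous fun a : ℝ =>
      ‖solOp k hk (deriv (source k hk) a) - solOp k hk (deriv (source k hk) α)‖ :=
    (((solOp k hk).continuous.comp (contDiff_deriv_source k hk).continuous).sub
      continuous_const).norm
  have h : Tendsto (fun a => ‖solOp k hk (deriv (source k hk) a)
      - solOp k hk (deriv (source k hk) α)‖) (𝓝 α) (𝓝 0) := by
    simpa using hc2.tendsto α
  filter_upwards [h.eventually (gt_mem_nhds hε)] with a ha ρ hρ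
  have e1 := ansatz_eq hk (slopeUnit k) (deriv (source k hk) a) ⟨ρ, hρ⟩
  have e2 := ansatz_eq hk (slopeUnit k) (deriv (source k hk) α) ⟨ρ, hρ⟩
  simp only at e1 e2
  rw [var, var, e1, e2]
  have hb := base_pos k hρ
  have hb1 := (base_lt_one k ρ).le
  have h3 := (solOp k hk (deriv (source k hk) a)
    - solOp k hk (deriv (source k hk) α)).norm_coe_le_norm ⟨ρ, hρ⟩
  simp only [BoundedContinuousFunction.coe_sub, Pi.sub_apply, Real.norm_eq_abs] at h3
  rw [add_sub_add_left_eq_sub, ← mul_sub, abs_mul, abs_of_pos (pow_pos hb 3)]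
  calc _ ≤ base k ρ ^ 1 * ‖solOp k hk (deriv (source k hk) a)
          - solOp k hk (deriv (source k hk) α)‖ := by
        gcongr ?_ * ?_
        exact pow_le_pow_of_le_one hb.le hb1 (by norm_num)
    _ < _ := by rw [pow_one, mul_comm]; gcongr

/-! ### Uniqueness for the singular initial value problem -/

/-- A maximum of `|D| / m` with positive value cannot be attained: comparing fluxes, `η m - D`
would be monotone and vanish at the maximum point, so that `D ≥ η m` all the way down to `0`. -/
lemma not_isMaxOn_div_base {k : ℕ} (hk : 1 ≤ k) {D D' R : ℝ → ℝ}
    (hD : ∀ ρ, 0 < ρ → HasDerivAt D (D' ρ) ρ)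
    (hD' : ∀ ρ, 0 < ρ → HasDerivAt (fun ρ => wt k ρ * D' ρ) (R ρ) ρ)
    (hR : ∀ ρ, 0 < ρ → |R ρ| ≤ k * wt k ρ * |D ρ| / ρ ^ 2)
    (h0 : Tendsto (fun ρ => D ρ / ρ) (𝓝[>] 0) (𝓝 0)) {r η : ℝ} (hr : 0 < r) (hη : 0 < η)
    (hmax : ∀ s, 0 < s → s ≤ r → |D s| ≤ η * base k s) (hat : D r = η * base k r) : False := by
  have hu : MonotoneOn (fun s => η * (wt k s * ((2 * k + 6) * rsq k s ^ 3)) - wt k s * D' s)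
      (Ioc 0 r) := by
    have hd : ∀ s, 0 < s → HasDerivAt
        (fun s => η * (wt k s * ((2 * k + 6) * rsq k s ^ 3)) - wt k s * D' s)
        (η * (wt k s * (base k s * (k + 3 * base k s ^ 4) / s ^ 2)) - R s) s := fun s hs =>
      ((hasDerivAt_wt_dbase k hs).const_mul η).sub (hD' s hs)
    refine monotoneOn_of_deriv_nonneg (convex_Ioc 0 r)
      (fun s hs => (hd s hs.1).continuousAt.continuousWithinAt)
      (fun s hs => (hd s (interior_subset hs).1).differentiableAt.differentiableWithinAt) ?_
    intro s hs
    have hs := interior_subset hs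
    rw [(hd s hs.1).deriv, sub_nonneg]
    have hw := wt_pos k hs.1
    have hb := base_pos k hs.1
    have hs0 := hs.1
    calc R s ≤ k * wt k s * |D s| / s ^ 2 := (le_abs_self _).trans (hR s hs.1)
      _ ≤ k * wt k s * (η * base k s) / s ^ 2 := by gcongr; exact hmax s hs.1 hs.2
      _ = η * (wt k s * (base k s * (k + 0) / s ^ 2)) := by ring
      _ ≤ _ := by gcongr; positivity
  -- by the mean value theorem, `D = o(ρ)` gives points near `0` at which `D'` is bounded, so the
  -- flux `w D'` is small there; this replaces the missing initial condition for the flux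
  have hsmall : ∀ δ : ℝ, 0 < δ → ∀ s, 0 < s → ∃ ξ, 0 < ξ ∧ ξ < s ∧ wt k ξ * D' ξ < δ := by
    intro δ hδ s hs
    have hev : ∀ᶠ e in 𝓝[>] (0 : ℝ), |D e / e| < 1 / 4 := by
      have := h0.abs; rw [abs_zero] at this
      exact this.eventually (gt_mem_nhds (by norm_num))
    have hwt : ∀ᶠ e in 𝓝[>] (0 : ℝ), wt k e < δ := by
      have : Tendsto (wt k) (𝓝[>] 0) (𝓝 (wt k 0)) :=
        ((continuous_wt k).tendsto 0).mono_left nhdsWithin_le_nhds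
      have h00 : wt k 0 = 0 := by simp [wt, show k ≠ 0 by omega]
      rw [h00] at this
      exact this.eventually (gt_mem_nhds hδ)
    obtain ⟨e0, he0, he⟩ := (mem_nhdsGT_iff_exists_Ioo_subset).1 (hev.and hwt)
    have he0 : 0 < e0 := he0
    set e := min (e0 / 2) (s / 2) with hedef
    have hepos : 0 < e := lt_min (by linarith) (by linarith)
    have hee0 : e < e0 := (min_le_left _ _).trans_lt (by linarith)
    have hes : e < s := (min_le_right _ _).trans_lt (by linarith)
    obtain ⟨ξ, hξ, hξe⟩ := exists_hasDerivAt_eq_slope D D' (show e / 2 < e by linarith)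
      (fun x hx => (hD x (by linarith [hx.1])).continuousAt.continuousWithinAt)
      (fun x hx => hD x (by linarith [hx.1]))
    have hξ0 : 0 < ξ := by linarith [hξ.1]
    have h1 := (he ⟨hepos, hee0⟩).1
    have h2 := (he (show e / 2 ∈ Ioo 0 e0 from ⟨by linarith, by linarith⟩)).1
    have h3 := (he (show ξ ∈ Ioo 0 e0 from ⟨hξ0, by linarith [hξ.2]⟩)).2
    rw [abs_lt, lt_div_iff₀ (by linarith), div_lt_iff₀ (by linarith)] at h1 h2
    refine ⟨ξ, hξ0, hξ.2.trans hes, ?_⟩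
    have h4 : D' ξ ≤ 1 := by
      rw [hξe, div_le_one (by linarith)]
      linarith [h1.2, h2.1]
    have hw := wt_pos k hξ0
    nlinarith
  have hD'le : ∀ s, 0 < s → s ≤ r → D' s ≤ η * ((2 * k + 6) * rsq k s ^ 3) := by
    intro s hs hsr
    have hw := wt_pos k hs
    by_contra! hcon
    have hδ : 0 < wt k s * (D' s - η * ((2 * k + 6) * rsq k s ^ 3)) :=
      mul_pos hw (by linarith)
    obtain ⟨ξ, hξ0, hξs, hξ⟩ := hsmall _ hδ s hs
    have h1 := hu ⟨hξ0, by linarith⟩ ⟨hs, hsr⟩ hξs.le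
    simp only at h1
    have h2 : 0 ≤ η * (wt k ξ * ((2 * k + 6) * rsq k ξ ^ 3)) := by
      have := wt_pos k hξ0; have := rsq_pos k ξ; positivity
    nlinarith
  have hmono : MonotoneOn (fun s => η * base k s - D s) (Ioc 0 r) := by
    have hd : ∀ s, 0 < s → HasDerivAt (fun s => η * base k s - D s)
        (η * ((2 * k + 6) * rsq k s ^ 3) - D' s) s := fun s hs =>
      ((hasDerivAt_base k s).const_mul η).sub (hD s hs)
    refine monotoneOn_of_deriv_nonneg (convex_Ioc 0 r)
      (fun s hs => (hd s hs.1).continuousAt.continuousWithinAt)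
      (fun s hs => (hd s (interior_subset hs).1).differentiableAt.differentiableWithinAt) ?_
    intro s hs
    have hs := interior_subset hs
    rw [(hd s hs.1).deriv, sub_nonneg]
    exact hD'le s hs.1 hs.2
  have hge : ∀ᶠ s in 𝓝[>] (0 : ℝ), η * rsq k s ≤ D s / s := by
    filter_upwards [Ioc_mem_nhdsGT hr] with s hs
    have := hmono hs ⟨hr, le_rfl⟩ hs.2
    simp only [hat, sub_self] at this
    rw [le_div_iff₀ hs.1]
    unfold base at this
    linarith
  have hlim : Tendsto (fun s => η * rsq k s) (𝓝[>] 0) (𝓝 (η * rsq k 0)) :=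
    ((continuous_const.mul (continuous_rsq k)).tendsto 0).mono_left nhdsWithin_le_nhds
  have := le_of_tendsto_of_tendsto hlim h0 hge
  have := mul_pos hη (rsq_pos k 0)
  linarith

lemma eq_zero_of_tendsto_div_zero {k : ℕ} (hk : 1 ≤ k) {D D' R : ℝ → ℝ}
    (hD : ∀ ρ, 0 < ρ → HasDerivAt D (D' ρ) ρ)
    (hD' : ∀ ρ, 0 < ρ → HasDerivAt (fun ρ => wt k ρ * D' ρ) (R ρ) ρ)
    (hR : ∀ ρ, 0 < ρ → |R ρ| ≤ k * wt k ρ * |D ρ| / ρ ^ 2)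
    (h0 : Tendsto (fun ρ => D ρ / ρ) (𝓝[>] 0) (𝓝 0)) {ρ : ℝ} (hρ : 0 < ρ) : D ρ = 0 := by
  by_contra hne
  have hcont : ContinuousOn (fun s => |D s| / base k s) (Icc 0 ρ) := by
    intro s hs
    rcases hs.1.eq_or_lt with rfl | hs0
    · have h1 : Tendsto (fun s => |D s| / base k s) (𝓝[>] 0) (𝓝 0) := by
        have hr : Tendsto (rsq k) (𝓝[>] 0) (𝓝 (rsq k 0)) :=
          ((continuous_rsq k).tendsto 0).mono_left nhdsWithin_le_nhds
        have h2 := h0.abs.div hr (rsq_pos k 0).ne'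
        rw [abs_zero, zero_div] at h2
        refine h2.congr' ?_
        filter_upwards [self_mem_nhdsWithin] with s hs
        have hs : 0 < s := hs
        simp only [Pi.div_apply]
        rw [abs_div, abs_of_pos hs, div_div]
        rfl
      refine (ContinuousWithinAt.mono (t := Ici 0) ?_ Icc_subset_Ici_self)
      rw [← continuousWithinAt_Ioi_iff_Ici]
      simpa [ContinuousWithinAt, base_zero] using h1
    · exact ((hD s hs0).continuousAt.abs.div (continuous_base k).continuousAt
        (base_pos k hs0).ne').continuousWithinAt
  obtain ⟨r, hr, hmax⟩ := isCompact_Icc.exists_isMaxOn ⟨ρ, hρ.le, le_rfl⟩ hcont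
  set η := |D r| / base k r with hηdef
  have hη : 0 < η := lt_of_lt_of_le (div_pos (abs_pos.2 hne) (base_pos k hρ))
    (hmax ⟨hρ.le, le_rfl⟩)
  have hr0 : 0 < r := by
    rcases hr.1.eq_or_lt with rfl | h
    · simp [hηdef, base_zero] at hη
    · exact h
  have hle : ∀ s, 0 < s → s ≤ r → |D s| ≤ η * base k s := fun s hs hsr => by
    have := hmax (show s ∈ Icc 0 ρ from ⟨hs.le, hsr.trans hr.2⟩)
    rwa [mem_ofPred_eq, div_le_iff₀ (base_pos k hs)] at this
  have heq : |D r| = η * base k r := by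
    rw [hηdef, div_mul_cancel₀ _ (base_pos k hr0).ne']
  rcases abs_cases (D r) with ⟨h, _⟩ | ⟨h, _⟩
  · exact not_isMaxOn_div_base hk hD hD' hR h0 hr0 hη hle (h ▸ heq)
  · refine not_isMaxOn_div_base hk (D := fun s => -D s) (D' := fun s => -D' s)
      (R := fun s => -R s) (fun s hs => (hD s hs).neg) (fun s hs => ?_) (fun s hs => ?_) ?_
      hr0 hη (fun s hs hsr => ?_) (h ▸ heq)
    · simpa using (hD' s hs).fun_neg
    · simpa using hR s hs
    · simpa [neg_div] using h0.neg
    · simpa using hle s hs hsr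

lemma IsProfile.tendsto_div {d : ℕ} {α : ℝ} {f : ℝ → ℝ} (hf : IsProfile d α f) :
    Tendsto (fun ρ => f ρ / ρ) (𝓝[>] 0) (𝓝 α) := by
  have h := hasDerivWithinAt_iff_tendsto_slope.1 hf.slope
  refine (h.mono_left (nhdsWithin_mono 0 ?_)).congr' ?_
  · intro x hx
    have hx : 0 < x := hx
    exact ⟨hx.le, hx.ne'⟩
  · exact Eventually.of_forall fun x => by simp [slope_def_field, hf.zero]

lemma IsProfile.hasDerivAt_wt_mul {k : ℕ} {α : ℝ} {f : ℝ → ℝ} (hf : IsProfile (k + 1) α f)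
    {ρ : ℝ} (hρ : 0 < ρ) :
    HasDerivAt (fun ρ => wt k ρ * deriv f ρ)
      (k * wt k ρ * Real.sin (2 * f ρ) / (2 * ρ ^ 2)) ρ := by
  refine ((hasDerivAt_wt k hρ).mul (hf.diff_deriv ρ hρ).hasDerivAt).congr_deriv ?_
  have h := hf.ode ρ hρ
  have hne := hρ.ne'
  push_cast at h
  rw [add_sub_cancel_right] at h
  have h2 : deriv (deriv f) ρ = k / (2 * ρ ^ 2) * Real.sin (2 * f ρ)
      - (k / ρ + ρ / 2) * deriv f ρ := by linarith
  rw [h2]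
  field_simp
  ring

/-- Uniqueness for the singular initial value problem. -/
lemma IsProfile.eq_of_nonneg {k : ℕ} (hk : 1 ≤ k) {α : ℝ} {f g : ℝ → ℝ}
    (hf : IsProfile (k + 1) α f) (hg : IsProfile (k + 1) α g) {ρ : ℝ} (hρ : 0 ≤ ρ) :
    f ρ = g ρ := by
  rcases hρ.eq_or_lt with rfl | hρ
  · rw [hf.zero, hg.zero]
  rw [← sub_eq_zero]
  refine eq_zero_of_tendsto_div_zero hk (D := fun ρ => f ρ - g ρ)
    (fun s hs => (hf.diff s hs).hasDerivAt.sub (hg.diff s hs).hasDerivAt)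
    (R := fun s => k * wt k s * Real.sin (2 * f s) / (2 * s ^ 2)
      - k * wt k s * Real.sin (2 * g s) / (2 * s ^ 2))
    (fun s hs => ?_) (fun s hs => ?_) ?_ hρ
  · simpa [mul_sub] using (hf.hasDerivAt_wt_mul hs).fun_sub (hg.hasDerivAt_wt_mul hs)
  · have hL : |Real.sin (2 * f s) - Real.sin (2 * g s)| ≤ |2 * f s - 2 * g s| := by
      simpa [Real.dist_eq] using Real.lipschitzWith_sin.dist_le_mul (2 * f s) (2 * g s)
    have hw := wt_pos k hs
    rw [← mul_sub, abs_mul, abs_two] at hL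
    calc _ = |k * wt k s / (2 * s ^ 2) * (Real.sin (2 * f s) - Real.sin (2 * g s))| := by
          congr 1; ring
      _ = k * wt k s / (2 * s ^ 2) * |Real.sin (2 * f s) - Real.sin (2 * g s)| := by
          rw [abs_mul, abs_of_nonneg (by positivity)]
      _ ≤ k * wt k s / (2 * s ^ 2) * (2 * |f s - g s|) := by gcongr
      _ = _ := by field_simp
  · have := hf.tendsto_div.sub hg.tendsto_div
    rw [sub_self] at this
    simpa [sub_div] using this

lemma isProfile_prof (k : ℕ) (hk : 1 ≤ k) (α : ℝ) : IsProfile (k + 1) α (prof k hk α) := by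
  have hF := isFlow_prof k hk α
  have hd : ∀ ρ, 0 < ρ → deriv (prof k hk α) =ᶠ[𝓝 ρ] fun s => profD k hk α s / s :=
    fun ρ hρ => by
      filter_upwards [Ioi_mem_nhds hρ] with s hs
      exact (hF.da s hs).deriv
  have hdd : ∀ ρ, 0 < ρ → HasDerivAt (deriv (prof k hk α)) _ ρ := fun ρ hρ =>
    ((hF.db ρ hρ).div (hasDerivAt_id ρ) hρ.ne').congr_of_eventuallyEq (hd ρ hρ)
  refine ⟨prof_zero k hk α, ?_, fun ρ hρ => (hF.da ρ hρ).differentiableAt,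
    fun ρ hρ => (hdd ρ hρ).differentiableAt, fun ρ hρ => ?_⟩
  · rw [hasDerivWithinAt_iff_tendsto_slope, Ici_sdiff_left]
    refine hF.ta.congr fun s => ?_
    simp [slope_def_field, prof_zero]
  · rw [(hdd ρ hρ).deriv, (hF.da ρ hρ).deriv]
    have := hρ.ne'
    push_cast
    simp only [id]
    field_simp
    ring

lemma psi_isProfile (k : ℕ) (hk : 1 ≤ k) (α : ℝ) : IsProfile (k + 1) α (psi (k + 1) α) :=
  Classical.epsilon_spec ⟨_, isProfile_prof k hk α⟩

lemma psi_eq_prof (k : ℕ) (hk : 1 ≤ k) (α : ℝ) {ρ : ℝ} (hρ : 0 ≤ ρ) :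
    psi (k + 1) α ρ = prof k hk α ρ :=
  (psi_isProfile k hk α).eq_of_nonneg hk (isProfile_prof k hk α) hρ

lemma hasDerivAt_psi_param (k : ℕ) (hk : 1 ≤ k) (α : ℝ) {ρ : ℝ} (hρ : 0 ≤ ρ) :
    HasDerivAt (fun a => psi (k + 1) a ρ) (var k hk α ρ) α := by
  simp only [psi_eq_prof k hk _ hρ]
  exact hasDerivAt_prof_param k hk α hρ

lemma phi_eq_var (k : ℕ) (hk : 1 ≤ k) (α : ℝ) {ρ : ℝ} (hρ : 0 ≤ ρ) :
    phi (k + 1) α ρ = var k hk α ρ :=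
  (hasDerivAt_psi_param k hk α hρ).deriv

/-! ### Energy, monotonicity and Sturm comparison -/

lemma exists_first_zero {f : ℝ → ℝ} (hc : ∀ ρ, 0 < ρ → ContinuousAt f ρ)
    (h0 : ∀ᶠ ρ in 𝓝[>] 0, 0 < f ρ) {r : ℝ} (hr : 0 < r) (hfr : f r ≤ 0) :
    ∃ s, 0 < s ∧ s ≤ r ∧ f s = 0 ∧ ∀ t, 0 < t → t < s → 0 < f t := by
  obtain ⟨e, he, hpos⟩ := (mem_nhdsGT_iff_exists_Ioo_subset).1 h0
  have he : 0 < e := he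
  have her : e ≤ r := by
    by_contra! h
    exact absurd (hpos ⟨hr, h⟩) (not_lt.2 hfr)
  have hcomp : IsCompact (Icc e r ∩ f ⁻¹' Iic 0) := by
    refine isCompact_Icc.of_isClosed_subset ?_ inter_subset_left
    exact ContinuousOn.preimage_isClosed_of_isClosed
      (fun s hs => (hc s (he.trans_le hs.1)).continuousWithinAt) isClosed_Icc isClosed_Iic
  obtain ⟨s, hs, hmin⟩ := hcomp.exists_isLeast ⟨r, ⟨her, le_rfl⟩, hfr⟩
  have hs0 : 0 < s := he.trans_le hs.1.1
  have hlt : ∀ t, 0 < t → t < s → 0 < f t := by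
    intro t ht hts
    rcases lt_or_ge t e with h | h
    · exact hpos ⟨ht, h⟩
    · by_contra! hcon
      exact absurd (hmin ⟨⟨h, hts.le.trans hs.1.2⟩, hcon⟩) (not_le.2 hts)
  refine ⟨s, hs0, hs.1.2, le_antisymm hs.2 ?_, hlt⟩
  refine ge_of_tendsto ((hc s hs0).continuousWithinAt (s := Iio s)).tendsto ?_
  filter_upwards [Ioo_mem_nhdsLT hs0] with t ht using (hlt t ht.1 ht.2).le

lemma monotoneOn_of_hasDerivAt {f f' : ℝ → ℝ} {s : Set ℝ} (hs : Convex ℝ s)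
    (hd : ∀ t ∈ s, HasDerivAt f (f' t) t) (hn : ∀ t ∈ s, 0 ≤ f' t) : MonotoneOn f s := by
  refine monotoneOn_of_deriv_nonneg hs (fun t ht => (hd t ht).continuousAt.continuousWithinAt)
    (fun t ht => (hd t (interior_subset ht)).differentiableAt.differentiableWithinAt) ?_
  intro t ht
  rw [(hd t (interior_subset ht)).deriv]
  exact hn t (interior_subset ht)

lemma le_of_monotoneOn_of_tendsto {f : ℝ → ℝ} {L r : ℝ} (hr : 0 < r)
    (hm : MonotoneOn f (Ioc 0 r)) (hL : Tendsto f (𝓝[>] 0) (𝓝 L)) : L ≤ f r := by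
  refine le_of_tendsto hL ?_
  filter_upwards [Ioc_mem_nhdsGT hr] with t ht using hm ht ⟨hr, le_rfl⟩ ht.2

lemma tendsto_zero_of_tendsto_div {f : ℝ → ℝ} {α : ℝ}
    (h : Tendsto (fun ρ => f ρ / ρ) (𝓝[>] 0) (𝓝 α)) : Tendsto f (𝓝[>] 0) (𝓝 0) := by
  have h1 : Tendsto (fun ρ : ℝ => ρ) (𝓝[>] 0) (𝓝 0) := nhdsWithin_le_nhds
  have h2 := h.mul h1
  rw [mul_zero] at h2
  refine h2.congr' ?_
  filter_upwards [self_mem_nhdsWithin] with ρ hρ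
  rw [div_mul_cancel₀]
  exact ne_of_gt hρ

lemma eventually_pos_of_tendsto_div {f : ℝ → ℝ} {α : ℝ} (hα : 0 < α)
    (h : Tendsto (fun ρ => f ρ / ρ) (𝓝[>] 0) (𝓝 α)) : ∀ᶠ ρ in 𝓝[>] 0, 0 < f ρ := by
  filter_upwards [h.eventually (lt_mem_nhds hα), self_mem_nhdsWithin] with ρ h1 h2
  have h2 : 0 < ρ := h2
  exact (div_pos_iff_of_pos_right h2).1 h1

/-- The weight `ρ^{k-1} e^{ρ²/4}`, for the logarithmic variable `log ρ`. -/
noncomputable def lwt (k : ℕ) (ρ : ℝ) : ℝ := wt k ρ / ρ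

lemma lwt_pos (k : ℕ) {ρ : ℝ} (h : 0 < ρ) : 0 < lwt k ρ := div_pos (wt_pos k h) h

lemma hasDerivAt_lwt (k : ℕ) {ρ : ℝ} (h : 0 < ρ) :
    HasDerivAt (lwt k) (lwt k ρ * (k - 1 + ρ ^ 2 / 2) / ρ) ρ := by
  refine ((hasDerivAt_wt k h).div (hasDerivAt_id ρ) h.ne').congr_deriv ?_
  have := h.ne'
  simp only [lwt, id]
  field_simp
  ring

lemma tendsto_wt_zero {k : ℕ} (hk : 1 ≤ k) : Tendsto (wt k) (𝓝[>] 0) (𝓝 0) := by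
  have h00 : wt k 0 = 0 := by simp [wt, show k ≠ 0 by omega]
  have := ((continuous_wt k).tendsto 0).mono_left (nhdsWithin_le_nhds (s := Ioi 0))
  rwa [h00] at this

namespace IsFlow

variable {k : ℕ} {α : ℝ} {a b : ℝ → ℝ}

lemma tendsto_a (h : IsFlow k α a b) : Tendsto a (𝓝[>] 0) (𝓝 0) := tendsto_zero_of_tendsto_div h.ta

lemma tendsto_b (h : IsFlow k α a b) : Tendsto b (𝓝[>] 0) (𝓝 0) := tendsto_zero_of_tendsto_div h.tb

/-- The energy `b²/2 + (k/4) cos 2a` of the damped pendulum. -/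
lemma hasDerivAt_energy (h : IsFlow k α a b) {ρ : ℝ} (hρ : 0 < ρ) :
    HasDerivAt (fun ρ => b ρ ^ 2 / 2 + k / 4 * Real.cos (2 * a ρ))
      (-(k - 1 + ρ ^ 2 / 2) * b ρ ^ 2 / ρ) ρ := by
  refine ((((h.db ρ hρ).pow 2).div_const 2).add
    ((((h.da ρ hρ).const_mul 2).cos).const_mul ((k : ℝ) / 4))).congr_deriv ?_
  have := hρ.ne'
  field_simp
  push_cast
  ring

lemma energy_antitone (h : IsFlow k α a b) (hk : 1 ≤ k) {r s : ℝ} (hr : 0 < r) (hrs : r ≤ s) :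
    b s ^ 2 / 2 + k / 4 * Real.cos (2 * a s) ≤ b r ^ 2 / 2 + k / 4 * Real.cos (2 * a r) := by
  have hk' : (1 : ℝ) ≤ k := by exact_mod_cast hk
  have := monotoneOn_of_hasDerivAt (convex_Ioi 0) (fun t ht => (h.hasDerivAt_energy ht).neg)
    (fun t ht => by
      have ht : 0 < t := ht
      have : 0 ≤ (k - 1 + t ^ 2 / 2) * b t ^ 2 / t := by
        have : 0 ≤ (k : ℝ) - 1 + t ^ 2 / 2 := by nlinarith [sq_nonneg t]
        positivity
      rw [neg_mul, neg_div, neg_neg]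
      exact this) hr (hr.trans_le hrs) hrs
  simp only [Pi.neg_apply] at this
  linarith

lemma energy_le (h : IsFlow k α a b) (hk : 1 ≤ k) {r : ℝ} (hr : 0 < r) :
    b r ^ 2 / 2 + k / 4 * Real.cos (2 * a r) ≤ k / 4 := by
  have h1 : Tendsto (fun ρ => b ρ ^ 2 / 2 + k / 4 * Real.cos (2 * a ρ)) (𝓝[>] 0)
      (𝓝 (0 ^ 2 / 2 + k / 4 * Real.cos (2 * 0))) :=
    ((h.tendsto_b.pow 2).div_const 2).add
      (((Real.continuous_cos.tendsto _).comp (h.tendsto_a.const_mul 2)).const_mul _)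
  have h2 : (0 : ℝ) ^ 2 / 2 + k / 4 * Real.cos (2 * 0) = k / 4 := by simp
  rw [h2] at h1
  refine ge_of_tendsto h1 ?_
  filter_upwards [Ioc_mem_nhdsGT hr] with t ht using h.energy_antitone hk ht.1 ht.2

lemma sq_b_le (h : IsFlow k α a b) (hk : 1 ≤ k) {r : ℝ} (hr : 0 < r) : b r ^ 2 ≤ k := by
  have h1 := h.energy_le hk hr
  have h2 := Real.neg_one_le_cos (2 * a r)
  have : (0 : ℝ) ≤ k := k.cast_nonneg
  nlinarith

/-- `(w̃ b)' = w̃ (k/2) sin 2a / ρ` with `w̃ = lwt k`. -/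
lemma hasDerivAt_lwt_mul (h : IsFlow k α a b) {ρ : ℝ} (hρ : 0 < ρ) :
    HasDerivAt (fun ρ => lwt k ρ * b ρ) (lwt k ρ * (k / 2 * Real.sin (2 * a ρ)) / ρ) ρ := by
  refine ((hasDerivAt_lwt k hρ).mul (h.db ρ hρ)).congr_deriv ?_
  have := hρ.ne'
  field_simp
  ring

lemma monotoneOn_a (h : IsFlow k α a b) {r : ℝ} (hb : ∀ t, 0 < t → t ≤ r → 0 ≤ b t) :
    MonotoneOn a (Ioc 0 r) :=
  monotoneOn_of_hasDerivAt (convex_Ioc 0 r) (fun t ht => h.da t ht.1)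
    (fun t ht => div_nonneg (hb t ht.1 ht.2) ht.1.le)

/-- As long as the profile stays below `π/2`, it is positive and increasing; moreover it is still
increasing at the first point where `π/2` is reached. -/
lemma b_pos (h : IsFlow k α a b) (hα : 0 < α) {R : ℝ}
    (hR : ∀ t, 0 < t → t < R → a t < Real.pi / 2) {r : ℝ} (hr : 0 < r) (hrR : r ≤ R) :
    0 < b r := by
  by_contra! hcon
  obtain ⟨s, hs, hsr, hbs, hlt⟩ := exists_first_zero (fun ρ hρ => (h.db ρ hρ).continuousAt)
    (eventually_pos_of_tendsto_div hα h.tb) hr hcon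
  have hmono : MonotoneOn a (Ioc 0 s) := h.monotoneOn_a fun t ht hts => by
    rcases hts.lt_or_eq with h1 | rfl
    · exact (hlt t ht h1).le
    · exact hbs.ge
  have hlim : a s ≤ Real.pi / 2 := by
    refine le_of_tendsto ((h.da s hs).continuousAt.continuousWithinAt (s := Iio s)).tendsto ?_
    filter_upwards [Ioo_mem_nhdsLT hs] with t ht
    exact (hR t ht.1 (ht.2.trans_le (hsr.trans hrR))).le
  have hE : MonotoneOn (fun ρ => lwt k ρ * b ρ) (Ioc 0 s) := by
    refine monotoneOn_of_hasDerivAt (convex_Ioc 0 s) (fun t ht => h.hasDerivAt_lwt_mul ht.1) ?_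
    intro t ht
    have h1 : 0 ≤ a t := le_of_monotoneOn_of_tendsto ht.1
      (hmono.mono (Ioc_subset_Ioc_right ht.2)) h.tendsto_a
    have h2 : a t ≤ Real.pi / 2 := (hmono ht ⟨hs, le_rfl⟩ ht.2).trans hlim
    have h3 : 0 ≤ Real.sin (2 * a t) :=
      Real.sin_nonneg_of_nonneg_of_le_pi (by linarith) (by linarith)
    have h4 := lwt_pos k ht.1
    have h5 := ht.1
    positivity
  have h1 := hE (show s / 2 ∈ Ioc 0 s from ⟨by linarith, by linarith⟩) ⟨hs, le_rfl⟩ (by linarith)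
  simp only [hbs, mul_zero] at h1
  have := mul_pos (lwt_pos k (half_pos hs)) (hlt (s / 2) (by linarith) (by linarith))
  linarith

lemma a_pos (h : IsFlow k α a b) (hα : 0 < α) {R : ℝ}
    (hR : ∀ t, 0 < t → t < R → a t < Real.pi / 2) {r : ℝ} (hr : 0 < r) (hrR : r ≤ R) :
    0 < a r := by
  have hm : MonotoneOn a (Ioc 0 r) := h.monotoneOn_a fun t ht hts =>
    (h.b_pos hα hR ht (hts.trans hrR)).le
  obtain ⟨t, ht, htr⟩ := ((eventually_pos_of_tendsto_div hα h.ta).and (Ioc_mem_nhdsGT hr)).exists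
  exact ht.trans_le (hm htr ⟨hr, le_rfl⟩ htr.2)

end IsFlow

/-- The Wronskian of a variation `p` and of the supersolution `sin 2a`. -/
noncomputable def wronskian (k : ℕ) (a b p q : ℝ → ℝ) (ρ : ℝ) : ℝ :=
  lwt k ρ * (q ρ * Real.sin (2 * a ρ) - p ρ * (2 * Real.cos (2 * a ρ) * b ρ))

namespace IsVariation

variable {k : ℕ} {α : ℝ} {a b p q : ℝ → ℝ}

lemma hasDerivAt_wronskian (hv : IsVariation k a p q) (h : IsFlow k α a b) {ρ : ℝ} (hρ : 0 < ρ) :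
    HasDerivAt (wronskian k a b p q)
      (lwt k ρ * (4 * Real.sin (2 * a ρ) * b ρ ^ 2 * p ρ) / ρ) ρ := by
  have ha := (h.da ρ hρ).const_mul 2
  refine ((hasDerivAt_lwt k hρ).mul (((hv.dq ρ hρ).mul ha.sin).sub
    ((hv.dp ρ hρ).mul ((ha.cos.const_mul 2).mul (h.db ρ hρ))))).congr_deriv ?_
  have := hρ.ne'
  simp only [Pi.mul_apply, Pi.sub_apply]
  field_simp
  ring

lemma tendsto_wronskian (hv : IsVariation k a p q) (h : IsFlow k α a b) (hk : 1 ≤ k) :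
    Tendsto (wronskian k a b p q) (𝓝[>] 0) (𝓝 0) := by
  have h2a := h.tendsto_a.const_mul 2
  have h1 := (tendsto_wt_zero hk).mul
    ((hv.tq.mul ((Real.continuous_sin.tendsto _).comp h2a)).sub
    (hv.tp.mul ((((Real.continuous_cos.tendsto _).comp h2a).const_mul 2).mul h.tendsto_b)))
  rw [zero_mul] at h1
  refine h1.congr' ?_
  filter_upwards [self_mem_nhdsWithin] with ρ hρ
  have : ρ ≠ 0 := ne_of_gt hρ
  simp only [wronskian, lwt, Function.comp]
  field_simp

lemma hasDerivAt_ratio (hv : IsVariation k a p q) (h : IsFlow k α a b) {ρ : ℝ} (hρ : 0 < ρ)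
    (hs : Real.sin (2 * a ρ) ≠ 0) :
    HasDerivAt (fun ρ => p ρ / Real.sin (2 * a ρ))
      (wronskian k a b p q ρ / (lwt k ρ * Real.sin (2 * a ρ) ^ 2 * ρ)) ρ := by
  refine ((hv.dp ρ hρ).div ((h.da ρ hρ).const_mul 2).sin hs).congr_deriv ?_
  have := hρ.ne'
  have := (lwt_pos k hρ).ne'
  unfold wronskian
  field_simp

lemma tendsto_ratio (hv : IsVariation k a p q) (h : IsFlow k α a b) (hα : 0 < α) :
    Tendsto (fun ρ => p ρ / Real.sin (2 * a ρ)) (𝓝[>] 0) (𝓝 (1 / (2 * α))) := by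
  have h1 : Tendsto (fun ρ => Real.sinc (2 * a ρ)) (𝓝[>] 0) (𝓝 1) := by
    have := (Real.continuous_sinc.tendsto _).comp (h.tendsto_a.const_mul 2)
    simpa [Function.comp_def] using this
  have h2 := hv.tp.div (h1.mul (h.ta.const_mul 2)) (by positivity)
  rw [one_mul] at h2
  refine h2.congr' ?_
  filter_upwards [self_mem_nhdsWithin, eventually_pos_of_tendsto_div hα h.ta] with ρ hρ ha
  have : ρ ≠ 0 := ne_of_gt hρ
  simp only [Pi.div_apply]
  rw [Real.sinc_of_ne_zero (by positivity)]
  field_simp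

/-- Sturm comparison: while `0 < a < π/2`, the function `sin 2a` is a positive supersolution of the
linearised equation, so that `p / sin 2a` increases from its initial value `1 / (2α)`. -/
lemma sturm (hv : IsVariation k a p q) (h : IsFlow k α a b) (hk : 1 ≤ k) (hα : 0 < α) {R : ℝ}
    (hR : ∀ t, 0 < t → t < R → a t < Real.pi / 2) :
    (∀ t, 0 < t → t < R → Real.sin (2 * a t) / (2 * α) ≤ p t ∧ 0 < p t) := by
  have hsin : ∀ t, 0 < t → t < R → 0 < Real.sin (2 * a t) := fun t ht htR =>
    Real.sin_pos_of_pos_of_lt_pi (by linarith [h.a_pos hα hR ht htR.le])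
      (by linarith [hR t ht htR])
  have key : ∀ r, 0 < r → r < R → (∀ t, 0 < t → t < r → 0 < p t) →
      Real.sin (2 * a r) / (2 * α) ≤ p r := by
    intro r hr hrR hp
    have hpr : 0 ≤ p r := by
      refine ge_of_tendsto ((hv.dp r hr).continuousAt.continuousWithinAt (s := Iio r)).tendsto ?_
      filter_upwards [Ioo_mem_nhdsLT hr] with t ht using (hp t ht.1 ht.2).le
    have hpn : ∀ t, 0 < t → t ≤ r → 0 ≤ p t := fun t ht htr => by
      rcases htr.lt_or_eq with h1 | rfl
      · exact (hp t ht h1).le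
      · exact hpr
    have hV : MonotoneOn (wronskian k a b p q) (Ioc 0 r) := by
      refine monotoneOn_of_hasDerivAt (convex_Ioc 0 r)
        (fun t ht => hv.hasDerivAt_wronskian h ht.1) fun t ht => ?_
      have h1 := hsin t ht.1 (ht.2.trans_lt hrR)
      have h2 := hpn t ht.1 ht.2
      have h3 := lwt_pos k ht.1
      have h4 := ht.1
      positivity
    have hV0 : ∀ t, 0 < t → t ≤ r → 0 ≤ wronskian k a b p q t := fun t ht htr =>
      le_of_monotoneOn_of_tendsto ht (hV.mono (Ioc_subset_Ioc_right htr))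
        (hv.tendsto_wronskian h hk)
    have hratio : MonotoneOn (fun ρ => p ρ / Real.sin (2 * a ρ)) (Ioc 0 r) := by
      refine monotoneOn_of_hasDerivAt (convex_Ioc 0 r)
        (fun t ht => hv.hasDerivAt_ratio h ht.1 (hsin t ht.1 (ht.2.trans_lt hrR)).ne')
        fun t ht => ?_
      have h3 := lwt_pos k ht.1
      have h4 := ht.1
      exact div_nonneg (hV0 t ht.1 ht.2) (by positivity)
    have := le_of_monotoneOn_of_tendsto hr hratio (hv.tendsto_ratio h hα)
    rw [le_div_iff₀ (hsin r hr hrR)] at this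
    linarith [show Real.sin (2 * a r) / (2 * α) = 1 / (2 * α) * Real.sin (2 * a r) by ring]
  have hpos : ∀ t, 0 < t → t < R → 0 < p t := by
    intro t ht htR
    by_contra! hcon
    obtain ⟨s, hs, hst, hps, hlt⟩ := exists_first_zero (fun ρ hρ => (hv.dp ρ hρ).continuousAt)
      (eventually_pos_of_tendsto_div one_pos hv.tp) ht hcon
    have h1 := key s hs (hst.trans_lt htR) hlt
    have h2 := hsin s hs (hst.trans_lt htR)
    rw [hps] at h1
    have : 0 < Real.sin (2 * a s) / (2 * α) := by positivity
    linarith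
  exact fun t ht htR => ⟨key t ht htR fun s hs hst => hpos s hs (hst.trans htR), hpos t ht htR⟩

end IsVariation

/-! ### Barriers and decay at infinity -/

lemma deriv_nonpos_of_first_zero {f : ℝ → ℝ} {f' s : ℝ} (hs : 0 < s) (hd : HasDerivAt f f' s)
    (h0 : f s = 0) (hpos : ∀ t, 0 < t → t < s → 0 < f t) : f' ≤ 0 := by
  have h := (hasDerivWithinAt_iff_tendsto_slope' (s := Iio s) (by simp)).1
    (hd.hasDerivWithinAt (s := Iio s))
  refine le_of_tendsto h ?_
  filter_upwards [Ioo_mem_nhdsLT hs] with t ht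
  rw [slope_def_field, h0]
  exact div_nonpos_of_nonneg_of_nonpos (by linarith [hpos t ht.1 ht.2]) (by linarith [ht.2])

/-- In the overdamped case `k ≥ 6` the curve `b = sin 2a` is a barrier in the phase plane. It meets
the line `a = π/2` at `b = 0`, so the profile cannot cross that line with positive speed. -/
lemma IsFlow.lt_pi_div_two_of_six_le {k : ℕ} {α : ℝ} {a b : ℝ → ℝ} (h : IsFlow k α a b)
    (hk : 6 ≤ k) (hα : 0 < α) {r : ℝ} (hr : 0 < r) : a r < Real.pi / 2 := by
  have hk' : (6 : ℝ) ≤ k := by exact_mod_cast hk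
  by_contra! hcon
  obtain ⟨s, hs, -, has, hlt⟩ := exists_first_zero (f := fun ρ => Real.pi / 2 - a ρ)
    (fun ρ hρ => continuousAt_const.sub (h.da ρ hρ).continuousAt)
    (by
      have := (h.tendsto_a.const_sub (Real.pi / 2)).eventually
        (lt_mem_nhds (show (0 : ℝ) < Real.pi / 2 - 0 by linarith [Real.pi_pos]))
      exact this) hr (by linarith)
  have hR : ∀ t, 0 < t → t < s → a t < Real.pi / 2 := fun t ht hts => by linarith [hlt t ht hts]
  have has : a s = Real.pi / 2 := by linarith
  have hbs := h.b_pos hα hR hs le_rfl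
  have hfs : Real.sin (2 * a s) - b s < 0 := by
    rw [has, mul_div_cancel₀ _ (two_ne_zero' ℝ), Real.sin_pi]
    linarith
  have hd : ∀ t, 0 < t → HasDerivAt (fun t => Real.sin (2 * a t) - b t)
      (Real.cos (2 * a t) * (2 * (b t / t))
        - (-(k - 1 + t ^ 2 / 2) * b t + k / 2 * Real.sin (2 * a t)) / t) t := fun t ht =>
    (((h.da t ht).const_mul 2).sin).sub (h.db t ht)
  have h0 : ∀ᶠ t in 𝓝[>] 0, 0 < Real.sin (2 * a t) - b t := by
    have h1 : Tendsto (fun ρ => Real.sinc (2 * a ρ)) (𝓝[>] 0) (𝓝 1) := by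
      have := (Real.continuous_sinc.tendsto _).comp (h.tendsto_a.const_mul 2)
      simpa [Function.comp_def] using this
    have h2 := (h1.mul (h.ta.const_mul 2)).sub h.tb
    refine eventually_pos_of_tendsto_div (α := 1 * (2 * α) - α) (by linarith) (h2.congr' ?_)
    filter_upwards [self_mem_nhdsWithin, eventually_pos_of_tendsto_div hα h.ta] with ρ hρ ha
    have : ρ ≠ 0 := ne_of_gt hρ
    rw [Real.sinc_of_ne_zero (by positivity)]
    field_simp
  obtain ⟨t, ht, hts, hft, hlt'⟩ := exists_first_zero (fun t ht => (hd t ht).continuousAt) h0 hs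
    hfs.le
  have hle := deriv_nonpos_of_first_zero ht (hd t ht) hft hlt'
  have hbt := h.b_pos hα hR ht hts
  have hsb : Real.sin (2 * a t) = b t := by linarith
  rw [hsb] at hle
  have hcos := Real.neg_one_le_cos (2 * a t)
  have h3 : Real.cos (2 * a t) * (2 * (b t / t))
        - (-(k - 1 + t ^ 2 / 2) * b t + k / 2 * b t) / t
      = b t * (2 * Real.cos (2 * a t) + k / 2 - 1 + t ^ 2 / 2) / t := by
    have := ht.ne'
    field_simp
    ring
  rw [h3] at hle
  have : 0 < b t * (2 * Real.cos (2 * a t) + k / 2 - 1 + t ^ 2 / 2) / t :=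
    div_pos (mul_pos hbt (by nlinarith [sq_pos_of_pos ht])) ht
  linarith

/-- If `a` increases to `π/2`, the distance to `π/2` is controlled by the speed. The function
`π/2 - a - 2 b/ρ²` is, up to a multiple of `ρ⁻²`, increasing to `0`. -/
lemma IsFlow.pi_div_two_sub_le {k : ℕ} {α : ℝ} {a b : ℝ → ℝ} (h : IsFlow k α a b)
    (hk : 1 ≤ k) (hα : 0 < α) (ha : ∀ t, 0 < t → a t < Real.pi / 2)
    (hlim : Tendsto a atTop (𝓝 (Real.pi / 2))) {r : ℝ} (hr : 0 < r) (hrk : 2 * k ≤ r ^ 2) :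
    Real.pi / 2 - a r ≤ 4 * b r / r ^ 2 := by
  have hR : ∀ {R : ℝ} t, 0 < t → t < R → a t < Real.pi / 2 := fun t ht _ => ha t ht
  have hb : ∀ t, 0 < t → 0 < b t := fun t ht => h.b_pos hα hR ht le_rfl
  have hm : ∀ s t, 0 < s → s ≤ t → a s ≤ a t := fun s t hs hst =>
    h.monotoneOn_a (r := t) (fun u hu _ => (hb u hu).le) ⟨hs, hst⟩ ⟨hs.trans_le hst, le_rfl⟩ hst
  set z := Real.pi / 2 - a r with hz
  have hz0 : 0 < z := by linarith [ha r hr]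
  have hd : ∀ t ∈ Ici r, HasDerivAt (fun t => Real.pi / 2 - a t - (2 * b t + k * z) / t ^ 2)
      ((2 * (k + 1) * b t + k * (2 * z - Real.sin (2 * a t))) / t ^ 3) t := by
    intro t ht
    have ht0 : 0 < t := hr.trans_le ht
    refine (((h.da t ht0).const_sub (Real.pi / 2)).sub
      ((((h.db t ht0).const_mul 2).add_const (k * z)).div (hasDerivAt_pow 2 t)
        (by positivity))).congr_deriv ?_
    have := ht0.ne'
    field_simp
    push_cast
    ring
  have hmono := monotoneOn_of_hasDerivAt (convex_Ici r) hd (fun t ht => by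
    have ht0 : 0 < t := hr.trans_le ht
    have h1 : Real.sin (2 * a t) ≤ 2 * z := by
      have h2 : Real.sin (2 * a t) = Real.sin (2 * (Real.pi / 2 - a t)) := by
        rw [mul_sub, mul_div_cancel₀ _ (two_ne_zero' ℝ), Real.sin_pi_sub]
      rw [h2]
      have h3 := Real.sin_le (x := 2 * (Real.pi / 2 - a t)) (by linarith [ha t ht0])
      linarith [hm r t hr ht]
    have := hb t ht0
    have : 0 ≤ 2 * z - Real.sin (2 * a t) := by linarith
    positivity)
  have hbt : Tendsto (fun t => (2 * b t + k * z) / t ^ 2) atTop (𝓝 0) := by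
    have h1 : Tendsto (fun t : ℝ => (2 * (k : ℝ) + 2 + k * z) / t ^ 2) atTop (𝓝 0) :=
      tendsto_const_nhds.div_atTop (tendsto_pow_atTop two_ne_zero)
    refine squeeze_zero' ?_ ?_ h1
    · filter_upwards [eventually_gt_atTop 0] with t ht
      have := hb t ht
      positivity
    · filter_upwards [eventually_gt_atTop 0] with t ht
      have h2 := h.sq_b_le hk ht
      have h3 : b t ≤ k + 1 := by nlinarith [sq_nonneg (b t - 1), (Nat.cast_nonneg k : (0:ℝ) ≤ k)]
      gcongr
      linarith
  have hY : Tendsto (fun t => Real.pi / 2 - a t - (2 * b t + k * z) / t ^ 2) atTop (𝓝 0) := by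
    simpa using (hlim.const_sub (Real.pi / 2)).sub hbt
  have hle : Real.pi / 2 - a r - (2 * b r + k * z) / r ^ 2 ≤ 0 := by
    refine ge_of_tendsto hY ?_
    filter_upwards [eventually_ge_atTop r] with t ht using hmono self_mem_Ici ht ht
  have hr2 : 0 < r ^ 2 := by positivity
  rw [le_div_iff₀ hr2]
  rw [← hz, sub_nonpos, le_div_iff₀ hr2] at hle
  nlinarith

/-- If `a` increases to `π/2`, then `w ψ'` stays bounded: such a solution decays like a Gaussian. -/
lemma IsFlow.lwt_mul_bounded {k : ℕ} {α : ℝ} {a b : ℝ → ℝ} (h : IsFlow k α a b)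
    (hk : 1 ≤ k) (hα : 0 < α) (ha : ∀ t, 0 < t → a t < Real.pi / 2)
    (hlim : Tendsto a atTop (𝓝 (Real.pi / 2))) :
    ∃ r C, 0 < r ∧ 0 < C ∧ ∀ t, r ≤ t → lwt k t * b t ≤ C := by
  have hR : ∀ {R : ℝ} t, 0 < t → t < R → a t < Real.pi / 2 := fun t ht _ => ha t ht
  have hb : ∀ t, 0 < t → 0 < b t := fun t ht => h.b_pos hα hR ht le_rfl
  have hk0 : (0 : ℝ) ≤ k := k.cast_nonneg
  have hr : (0 : ℝ) < 2 * k + 1 := by positivity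
  refine ⟨2 * k + 1, lwt k (2 * k + 1) * b (2 * k + 1) * Real.exp (2 * k / (2 * k + 1) ^ 2), hr,
    mul_pos (mul_pos (lwt_pos k hr) (hb _ hr)) (Real.exp_pos _), fun t ht => ?_⟩
  have ht0 : 0 < t := hr.trans_le ht
  have hd : ∀ s ∈ Ici (2 * (k : ℝ) + 1), HasDerivAt
      (fun s => -(lwt k s * b s * Real.exp (2 * k / s ^ 2)))
      (lwt k s * Real.exp (2 * k / s ^ 2) *
        (4 * k * b s / s ^ 2 - k / 2 * Real.sin (2 * a s)) / s) s := by
    intro s hs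
    have hs0 : 0 < s := hr.trans_le hs
    have he := ((hasDerivAt_pow 2 s).fun_inv (by positivity)).const_mul (2 * (k : ℝ))
    refine ((h.hasDerivAt_lwt_mul hs0).mul
      (he.congr_of_eventuallyEq (f₁ := fun s => 2 * (k : ℝ) / s ^ 2)
        (Eventually.of_forall fun s => div_eq_mul_inv _ _)).exp).neg.congr_deriv ?_
    have := hs0.ne'
    field_simp
    push_cast
    ring
  have hmono := monotoneOn_of_hasDerivAt (convex_Ici _) hd (fun s hs => by
    have hs' : 2 * (k : ℝ) + 1 ≤ s := hs
    have hs0 : 0 < s := hr.trans_le hs'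
    have h1 := h.pi_div_two_sub_le hk hα ha hlim hs0 (by nlinarith)
    have h2 : Real.sin (2 * a s) ≤ 2 * (Real.pi / 2 - a s) := by
      have h2 : Real.sin (2 * a s) = Real.sin (2 * (Real.pi / 2 - a s)) := by
        rw [mul_sub, mul_div_cancel₀ _ (two_ne_zero' ℝ), Real.sin_pi_sub]
      rw [h2]
      exact Real.sin_le (by linarith [ha s hs0])
    have h3 : 0 ≤ 4 * k * b s / s ^ 2 - k / 2 * Real.sin (2 * a s) := by
      have : 4 * k * b s / s ^ 2 = k * (4 * b s / s ^ 2) := by ring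
      rw [this]
      nlinarith
    have := lwt_pos k hs0
    have := Real.exp_pos (2 * k / s ^ 2)
    positivity)
  have h1 := hmono self_mem_Ici ht ht
  simp only [neg_le_neg_iff] at h1
  refine le_trans ?_ h1
  have h2 : 1 ≤ Real.exp (2 * k / t ^ 2) := Real.one_le_exp (by positivity)
  have := mul_pos (lwt_pos k ht0) (hb t ht0)
  nlinarith

/-- If the profile increases to exactly `π/2`, then the variation has a positive limit: the
Wronskian with `sin 2a` is bounded below, while `w (sin 2a)'` is bounded. -/
lemma IsVariation.lim_pos_of_tendsto_pi_div_two {k : ℕ} {α : ℝ} {a b p q : ℝ → ℝ}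
    (hv : IsVariation k a p q) (h : IsFlow k α a b) (hk : 1 ≤ k) (hα : 0 < α)
    (ha : ∀ t, 0 < t → a t < Real.pi / 2) (hlim : Tendsto a atTop (𝓝 (Real.pi / 2))) {L : ℝ}
    (hL : Tendsto p atTop (𝓝 L)) : 0 < L := by
  have hR : ∀ {R : ℝ} t, 0 < t → t < R → a t < Real.pi / 2 := fun t ht _ => ha t ht
  have hb : ∀ t, 0 < t → 0 < b t := fun t ht => h.b_pos hα hR ht le_rfl
  have hp : ∀ t, 0 < t → 0 < p t := fun t ht =>
    (hv.sturm h hk hα (R := t + 1) hR t ht (by linarith)).2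
  have hsin : ∀ t, 0 < t → 0 < Real.sin (2 * a t) := fun t ht =>
    Real.sin_pos_of_pos_of_lt_pi (by linarith [h.a_pos hα hR ht le_rfl]) (by linarith [ha t ht])
  obtain ⟨r, C, hr, hC, hbd⟩ := h.lwt_mul_bounded hk hα ha hlim
  have hV : StrictMonoOn (wronskian k a b p q) (Ioi 0) := by
    refine strictMonoOn_of_deriv_pos (convex_Ioi 0)
      (fun t ht => (hv.hasDerivAt_wronskian h ht).continuousAt.continuousWithinAt) fun t ht => ?_
    have ht : 0 < t := interior_subset ht
    rw [(hv.hasDerivAt_wronskian h ht).deriv]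
    have := hb t ht; have := hp t ht; have := hsin t ht; have := lwt_pos k ht
    positivity
  have hV0 : 0 < wronskian k a b p q r := by
    refine lt_of_le_of_lt ?_ (hV (half_pos hr) hr (by linarith))
    exact le_of_monotoneOn_of_tendsto (half_pos hr) (hV.monotoneOn.mono Ioc_subset_Ioi_self)
      (hv.tendsto_wronskian h hk)
  set c := wronskian k a b p q r / (2 * C) with hc
  have hc0 : 0 < c := by positivity
  have hd : ∀ t ∈ Ici r, HasDerivAt
      (fun t => p t / Real.sin (2 * a t) - c / Real.sin (2 * a t))
      ((wronskian k a b p q t + 2 * c * Real.cos (2 * a t) * (lwt k t * b t)) /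
        (lwt k t * Real.sin (2 * a t) ^ 2 * t)) t := by
    intro t ht
    have ht0 : 0 < t := hr.trans_le ht
    have h1 := ((h.da t ht0).const_mul 2).sin.fun_inv (hsin t ht0).ne'
    refine ((hv.hasDerivAt_ratio h ht0 (hsin t ht0).ne').sub
      ((h1.const_mul c).congr_of_eventuallyEq (f₁ := fun t => c / Real.sin (2 * a t))
        (Eventually.of_forall fun s => div_eq_mul_inv _ _))).congr_deriv ?_
    have := ht0.ne'
    have := (lwt_pos k ht0).ne'
    have := (hsin t ht0).ne'
    field_simp
    ring
  have hmono := monotoneOn_of_hasDerivAt (convex_Ici r) hd (fun t ht => by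
    have ht0 : 0 < t := hr.trans_le ht
    have h1 := hV.monotoneOn hr ht0 ht
    have h2 := hbd t ht
    have h3 := lwt_pos k ht0
    have h4 : 0 < lwt k t * b t := mul_pos h3 (hb t ht0)
    have h5 := Real.neg_one_le_cos (2 * a t)
    have h6 : 2 * c * C = wronskian k a b p q r := by rw [hc]; field_simp
    have h7 : 0 ≤ wronskian k a b p q t + 2 * c * Real.cos (2 * a t) * (lwt k t * b t) := by
      have h8 : 2 * c * (lwt k t * b t) ≤ 2 * c * C := by gcongr
      have h9 : 0 ≤ (Real.cos (2 * a t) + 1) * (2 * c * (lwt k t * b t)) :=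
        mul_nonneg (by linarith) (by positivity)
      linarith
    have := hsin t ht0
    positivity)
  have hsl : Tendsto (fun t => Real.sin (2 * a t)) atTop (𝓝 0) := by
    have := (Real.continuous_sin.tendsto _).comp (hlim.const_mul 2)
    rwa [mul_div_cancel₀ _ (two_ne_zero' ℝ), Real.sin_pi] at this
  set K := p r / Real.sin (2 * a r) - c / Real.sin (2 * a r) with hK
  have hlim2 : Tendsto (fun t => K * Real.sin (2 * a t) + c) atTop (𝓝 c) := by
    simpa using (hsl.const_mul K).add_const c
  refine hc0.trans_le (le_of_tendsto_of_tendsto hlim2 hL ?_)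
  filter_upwards [eventually_ge_atTop r] with t ht
  have h1 := hmono self_mem_Ici ht ht
  have h2 := hsin t (hr.trans_le ht)
  simp only at h1
  rw [← hK, ← sub_div, le_div_iff₀ h2] at h1
  linarith

/-! ### Oscillation in the underdamped case -/

/-- Up to the first time `a = π/4`, the speed satisfies `b ≤ a`: indeed
`(ρ^k (b - a))' ≤ 0`, as `sin 2a ≤ 2a`. -/
lemma IsFlow.b_le_a {k : ℕ} {α : ℝ} {a b : ℝ → ℝ} (h : IsFlow k α a b) (hk : 1 ≤ k) (hα : 0 < α)
    {r : ℝ} (hr : 0 < r) (hR : ∀ t, 0 < t → t < r → a t < Real.pi / 2) : b r ≤ a r := by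
  have hd : ∀ t ∈ Ioc 0 r, HasDerivAt (fun t => t ^ k * (a t - b t))
      (t ^ k * (t ^ 2 / 2 * b t + k / 2 * (2 * a t - Real.sin (2 * a t))) / t) t := by
    intro t ht
    have ht0 := ht.1
    refine ((hasDerivAt_pow k t).mul ((h.da t ht0).sub (h.db t ht0))).congr_deriv ?_
    obtain ⟨j, rfl⟩ : ∃ j, k = j + 1 := ⟨k - 1, by omega⟩
    have := ht0.ne'
    simp only [Pi.sub_apply, Nat.add_sub_cancel]
    push_cast
    field_simp
    ring
  have hmono := monotoneOn_of_hasDerivAt (convex_Ioc 0 r) hd (fun t ht => by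
    have h1 := h.b_pos hα hR ht.1 ht.2
    have h2 := h.a_pos hα hR ht.1 ht.2
    have h3 := Real.sin_le (x := 2 * a t) (by linarith)
    have h4 : 0 ≤ 2 * a t - Real.sin (2 * a t) := by linarith
    have := ht.1
    positivity)
  have hlim : Tendsto (fun t => t ^ k * (a t - b t)) (𝓝[>] 0) (𝓝 0) := by
    have h1 : Tendsto (fun t : ℝ => t ^ k) (𝓝[>] 0) (𝓝 (0 ^ k)) :=
      ((continuous_pow k).tendsto 0).mono_left nhdsWithin_le_nhds
    simpa using h1.mul (h.tendsto_a.sub h.tendsto_b)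
  have h1 := le_of_monotoneOn_of_tendsto hr hmono hlim
  have h2 := (mul_nonneg_iff_of_pos_left (pow_pos hr k)).1 h1
  linarith

/-- The increasing quantity controlling `∫ sin² 2a d(log ρ)`: with `c = cos 2a`, `F = k - 1 + ρ²/2`
and `e` the energy, it is `-ρ c' - F c + ρ²/2 - 4 e / (k - 1)`. -/
noncomputable def virial (k : ℕ) (a b : ℝ → ℝ) (ρ : ℝ) : ℝ :=
  2 * (Real.sin (2 * a ρ) * b ρ) - (k - 1 + ρ ^ 2 / 2) * Real.cos (2 * a ρ) + ρ ^ 2 / 2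
    - 4 / (k - 1) * (b ρ ^ 2 / 2 + k / 4 * Real.cos (2 * a ρ))

lemma IsFlow.hasDerivAt_virial {k : ℕ} {α : ℝ} {a b : ℝ → ℝ} (h : IsFlow k α a b) {ρ : ℝ}
    (hρ : 0 < ρ) :
    HasDerivAt (virial k a b)
      ((k * Real.sin (2 * a ρ) ^ 2 + 4 * Real.cos (2 * a ρ) * b ρ ^ 2
        + ρ ^ 2 * (1 - Real.cos (2 * a ρ))
        + 4 / (k - 1) * ((k - 1 + ρ ^ 2 / 2) * b ρ ^ 2)) / ρ) ρ := by
  have ha := (h.da ρ hρ).const_mul 2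
  have hq := (hasDerivAt_pow 2 ρ).div_const (2 : ℝ)
  refine (((((ha.sin.mul (h.db ρ hρ)).const_mul 2).sub
    ((hq.const_add ((k : ℝ) - 1)).mul ha.cos)).add hq).sub
    ((h.hasDerivAt_energy hρ).const_mul (4 / ((k : ℝ) - 1)))).congr_deriv ?_
  have := hρ.ne'
  field_simp
  push_cast
  ring

lemma IsFlow.abs_virial_le {k : ℕ} {α : ℝ} {a b : ℝ → ℝ} (h : IsFlow k α a b) (hk : 2 ≤ k)
    (hk5 : k ≤ 5) {ρ : ℝ} (hρ : 0 < ρ) (hρ1 : ρ ≤ 1 / 2) : |virial k a b ρ| ≤ 14 := by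
  have hk' : (2 : ℝ) ≤ k := by exact_mod_cast hk
  have hk5' : (k : ℝ) ≤ 5 := by exact_mod_cast hk5
  have hb2 := h.sq_b_le (by omega) hρ
  have hb : |b ρ| ≤ 3 := abs_le_of_sq_le_sq (by nlinarith) (by norm_num)
  have hsb : |Real.sin (2 * a ρ) * b ρ| ≤ 3 := by
    rw [abs_mul]
    nlinarith [Real.abs_sin_le_one (2 * a ρ), abs_nonneg (b ρ), abs_nonneg (Real.sin (2 * a ρ))]
  have hρ2 : ρ ^ 2 ≤ 1 / 4 := by nlinarith
  have hρ0 := sq_nonneg ρ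
  have hFc : |(k - 1 + ρ ^ 2 / 2) * Real.cos (2 * a ρ)| ≤ 5 := by
    have hF : (0 : ℝ) ≤ k - 1 + ρ ^ 2 / 2 := by linarith
    rw [abs_mul, abs_of_nonneg hF]
    nlinarith [Real.abs_cos_le_one (2 * a ρ), abs_nonneg (Real.cos (2 * a ρ))]
  have he : |4 / ((k : ℝ) - 1) * (b ρ ^ 2 / 2 + k / 4 * Real.cos (2 * a ρ))| ≤ 2 := by
    have h1 : |b ρ ^ 2 / 2 + k / 4 * Real.cos (2 * a ρ)| ≤ (k : ℝ) / 4 := by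
      refine abs_le.2 ⟨?_, h.energy_le (by omega) hρ⟩
      nlinarith [Real.neg_one_le_cos (2 * a ρ), sq_nonneg (b ρ)]
    have hk1 : (0 : ℝ) < k - 1 := by linarith
    rw [abs_mul, abs_of_pos (by positivity), div_mul_eq_mul_div, div_le_iff₀ hk1]
    linarith
  rw [abs_le] at hsb hFc he ⊢
  unfold virial
  constructor <;> linarith

/-- Oscillation in the underdamped case `2 ≤ k ≤ 5`. If the profile reaches `π/4` at a tiny radius
`r`, then it spends a long logarithmic time near the unstable equilibrium `π/2` in the sense that
`∫ (1 + cos 2a) d(log ρ)` is bounded, and the Riccati variable `q/p + F/2` of a positive variation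
would blow up before `ρ = 1/2`. The constant satisfies `160 / 2 > π + (8/3) (14 + 14) + 1/2`, where
`14` bounds the virial quantity. -/
lemma IsVariation.exp_lt_of_pos {k : ℕ} {α : ℝ} {a b p q : ℝ → ℝ} (hv : IsVariation k a p q)
    (h : IsFlow k α a b) (hk : 2 ≤ k) (hk5 : k ≤ 5) (hα : 0 < α) (hp : ∀ t, 0 < t → 0 < p t)
    {r : ℝ} (hr : 0 < r) (har : a r = Real.pi / 4) (hlt : ∀ t, 0 < t → t < r → a t < Real.pi / 4) :
    Real.exp (-160) < r := by
  have hk' : (2 : ℝ) ≤ k := by exact_mod_cast hk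
  have hk5' : (k : ℝ) ≤ 5 := by exact_mod_cast hk5
  by_contra! hcon
  have hr1 : r < 1 / 2 := by
    refine hcon.trans_lt ?_
    have : Real.exp (-160) < Real.exp (-1) := Real.exp_lt_exp.2 (by norm_num)
    have h2 : Real.exp (-1) < 1 / 2 := by
      rw [Real.exp_neg]
      have := Real.exp_one_gt_d9
      rw [inv_lt_comm₀ (Real.exp_pos 1) (by norm_num)]
      norm_num; linarith
    linarith
  have hR : ∀ t, 0 < t → t < r → a t < Real.pi / 2 := fun t ht htr => by
    linarith [hlt t ht htr, Real.pi_pos]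
  have hcos : ∀ t, r ≤ t → Real.cos (2 * a t) ≤ 5 / 8 := by
    intro t ht
    have h1 := h.energy_antitone (by omega) hr ht
    have h2 := h.b_le_a (by omega) hα hr hR
    have h3 := h.b_pos hα hR hr le_rfl
    have h4 : Real.cos (2 * a r) = 0 := by
      rw [har, show 2 * (Real.pi / 4) = Real.pi / 2 by ring, Real.cos_pi_div_two]
    rw [h4] at h1
    rw [har] at h2
    have h5 := Real.pi_lt_d2
    have h6 : b r ^ 2 ≤ 5 / 8 := by nlinarith [Real.pi_pos]
    by_contra! h7
    nlinarith [sq_nonneg (b t)]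
  set y : ℝ → ℝ := fun t => q t / p t + (k - 1 + t ^ 2 / 2) / 2 with hy
  have hdy : ∀ t, 0 < t → HasDerivAt y ((-(y t) ^ 2 + (k - 1 + t ^ 2 / 2) ^ 2 / 4
      + k * Real.cos (2 * a t) + t ^ 2 / 2) / t) t := by
    intro t ht
    refine (((hv.dq t ht).div (hv.dp t ht) (hp t ht).ne').add
      ((((hasDerivAt_pow 2 t).div_const 2).const_add ((k : ℝ) - 1)).div_const 2)).congr_deriv ?_
    have := ht.ne'
    have := (hp t ht).ne'
    simp only [hy]
    field_simp
    push_cast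
    ring
  have hdG : ∀ t ∈ Icc r (1 / 2), HasDerivAt
      (fun t => 8 / 3 * virial k a b t - Real.arctan (y t) - 1 / 2 * Real.log t) _ t := fun t ht =>
    have ht0 : 0 < t := hr.trans_le ht.1
    (((h.hasDerivAt_virial ht0).const_mul (8 / 3)).sub (hdy t ht0).arctan).sub
      ((Real.hasDerivAt_log ht0.ne').const_mul (1 / 2))
  have hmono := monotoneOn_of_hasDerivAt (convex_Icc _ _) hdG (fun t ht => by
    have ht0 : 0 < t := hr.trans_le ht.1
    have ht2 : t ^ 2 ≤ 1 / 4 := by nlinarith [ht.2]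
    have hC := hcos t ht.1
    have hC1 := Real.neg_one_le_cos (2 * a t)
    have hsq := Real.sin_sq_add_cos_sq (2 * a t)
    set c := Real.cos (2 * a t)
    set S := Real.sin (2 * a t)
    have hk1 : (0 : ℝ) < k - 1 := by linarith
    -- the virial identity dominates `k sin² 2a`
    have hvir : k * S ^ 2 ≤ k * S ^ 2 + 4 * c * b t ^ 2 + t ^ 2 * (1 - c)
        + 4 / (k - 1) * ((k - 1 + t ^ 2 / 2) * b t ^ 2) := by
      have h1 : 4 * b t ^ 2 ≤ 4 / (k - 1) * ((k - 1 + t ^ 2 / 2) * b t ^ 2) := by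
        rw [div_mul_eq_mul_div, le_div_iff₀ hk1]
        nlinarith [mul_nonneg (sq_nonneg t) (sq_nonneg (b t))]
      nlinarith [mul_nonneg (sq_nonneg t) (show 0 ≤ 1 - c by linarith),
        mul_nonneg (sq_nonneg (b t)) (show 0 ≤ 1 + c by linarith)]
    -- away from `cos 2a = 1`, it also dominates `k (1 + cos 2a)`
    have hcc : k * (1 + c) ≤ 8 / 3 * (k * S ^ 2) := by
      have : S ^ 2 = (1 - c) * (1 + c) := by linarith
      rw [this]
      have h2 : 0 ≤ k * (1 + c) * (5 / 8 - c) :=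
        mul_nonneg (mul_nonneg (by linarith) (by linarith)) (by linarith)
      nlinarith
    -- underdamping: `F²/4 < k` with room to spare when `ρ ≤ 1/2`
    have hQ : ((k : ℝ) - 1 + t ^ 2 / 2) ^ 2 / 4 + t ^ 2 / 2 ≤ k - 1 / 2 := by
      have h3 : ((k : ℝ) - 1 + t ^ 2 / 2) ^ 2 ≤ (k - 1 + 1 / 8) ^ 2 := by
        have := sq_nonneg t
        exact pow_le_pow_left₀ (by linarith) (by linarith) 2
      nlinarith
    have hy1 : 0 < 1 + y t ^ 2 := by positivity
    have hric : 1 / (1 + y t ^ 2) * (-(y t) ^ 2 + (k - 1 + t ^ 2 / 2) ^ 2 / 4 + k * c + t ^ 2 / 2)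
        ≤ -1 / 2 + k * (1 + c) := by
      rw [one_div, inv_mul_le_iff₀ hy1]
      have : 0 ≤ y t ^ 2 * (k * (1 + c)) :=
        mul_nonneg (sq_nonneg _) (mul_nonneg (by linarith) (by linarith))
      nlinarith [sq_nonneg (y t)]
    have hfin : 8 / 3 * ((k * S ^ 2 + 4 * c * b t ^ 2 + t ^ 2 * (1 - c)
        + 4 / (k - 1) * ((k - 1 + t ^ 2 / 2) * b t ^ 2)) / t)
        - 1 / (1 + y t ^ 2) *
          ((-(y t) ^ 2 + (k - 1 + t ^ 2 / 2) ^ 2 / 4 + k * c + t ^ 2 / 2) / t)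
        - 1 / 2 * t⁻¹
        = (8 / 3 * (k * S ^ 2 + 4 * c * b t ^ 2 + t ^ 2 * (1 - c)
        + 4 / (k - 1) * ((k - 1 + t ^ 2 / 2) * b t ^ 2))
        - 1 / (1 + y t ^ 2) * (-(y t) ^ 2 + (k - 1 + t ^ 2 / 2) ^ 2 / 4 + k * c + t ^ 2 / 2)
        - 1 / 2) / t := by ring
    rw [hfin]
    exact div_nonneg (by linarith) ht0.le)
  -- the monotone quantity is bounded apart from its logarithmic term, hence `log r` is bounded below
  have hG := hmono ⟨le_rfl, hr1.le⟩ ⟨hr1.le, le_rfl⟩ hr1.le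
  simp only at hG
  have hB1 := abs_le.1 (h.abs_virial_le hk hk5 hr hr1.le)
  have hB2 := abs_le.1 (h.abs_virial_le hk hk5 (show (0 : ℝ) < 1 / 2 by norm_num) le_rfl)
  have ha1 := Real.arctan_lt_pi_div_two (y r)
  have ha2 := Real.neg_pi_div_two_lt_arctan (y (1 / 2))
  have hl1 : Real.log r ≤ -160 := by
    rw [← Real.log_exp (-160)]
    exact Real.log_le_log hr hcon
  have hl2 : -1 ≤ Real.log (1 / 2) := by
    have := Real.log_two_lt_d9
    rw [one_div, Real.log_inv]
    linarith
  have := Real.pi_lt_d2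
  linarith

/-- Profiles of large slope reach `π/4` at arbitrarily small radii: otherwise the Sturm bound
`φ ≥ sin 2ψ / (2α)` makes `tan ψ_α(ρ) / α` nondecreasing in `α`. -/
lemma exists_prof_eq_pi_div_four (k : ℕ) (hk : 1 ≤ k) {R : ℝ} (hR : 0 < R) :
    ∃ α r, 0 < α ∧ 0 < r ∧ r ≤ R ∧ prof k hk α r = Real.pi / 4 ∧
      ∀ t, 0 < t → t < r → prof k hk α t < Real.pi / 4 := by
  by_contra! hcon
  have hlt : ∀ α, 0 < α → ∀ t, 0 < t → t ≤ R → prof k hk α t < Real.pi / 4 := by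
    intro α hα t ht htR
    by_contra! h1
    have h := isFlow_prof k hk α
    obtain ⟨s, hs, hst, hs0, hs1⟩ := exists_first_zero
      (f := fun ρ => Real.pi / 4 - prof k hk α ρ)
      (fun ρ hρ => continuousAt_const.sub (h.da ρ hρ).continuousAt)
      ((h.tendsto_a.const_sub (Real.pi / 4)).eventually
        (lt_mem_nhds (show (0 : ℝ) < Real.pi / 4 - 0 by linarith [Real.pi_pos]))) ht (by linarith)
    obtain ⟨u, hu, hus, hu2⟩ := hcon α s hα hs (hst.trans htR) (by linarith)
    linarith [hs1 u hu hus]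
  set ρ := R / 2 with hρ
  have hρ0 : 0 < ρ := by positivity
  have hπ := Real.pi_pos
  have hlt2 : ∀ α, 0 < α → ∀ t, 0 < t → t < R → prof k hk α t < Real.pi / 2 :=
    fun α hα t ht htR => by linarith [hlt α hα t ht htR.le]
  have hapos : ∀ α, 0 < α → 0 < prof k hk α ρ := fun α hα =>
    (isFlow_prof k hk α).a_pos hα (hlt2 α hα) hρ0 (by linarith)
  have hcospos : ∀ α, 0 < α → 0 < Real.cos (prof k hk α ρ) := fun α hα =>
    Real.cos_pos_of_mem_Ioo ⟨by linarith [hapos α hα], by linarith [hlt α hα ρ hρ0 (by linarith)]⟩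
  have hmono : MonotoneOn (fun α => Real.tan (prof k hk α ρ) / α) (Ioi 0) := by
    have hd : ∀ α ∈ Ioi (0 : ℝ), HasDerivAt (fun α => Real.tan (prof k hk α ρ) / α)
        ((1 / Real.cos (prof k hk α ρ) ^ 2 * var k hk α ρ * α - Real.tan (prof k hk α ρ) * 1)
          / α ^ 2) α := fun α hα =>
      (HasDerivAt.comp (h₂ := Real.tan) α (Real.hasDerivAt_tan (hcospos α hα).ne')
        (hasDerivAt_prof_param k hk α hρ0.le)).fun_div (hasDerivAt_id' α) (ne_of_gt hα)
    refine monotoneOn_of_hasDerivAt (convex_Ioi 0) hd fun α hα => ?_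
    have hα : 0 < α := hα
    have h1 := ((isVariation_var k hk α).sturm (isFlow_prof k hk α) hk hα (hlt2 α hα) ρ hρ0
      (by linarith)).1
    have hc := hcospos α hα
    rw [Real.sin_two_mul, div_le_iff₀ (by positivity)] at h1
    refine div_nonneg ?_ (sq_nonneg _)
    rw [mul_one]
    rw [Real.tan_eq_sin_div_cos, sub_nonneg, div_le_iff₀ hc]
    have h3 : 1 / Real.cos (prof k hk α ρ) ^ 2 * var k hk α ρ * α * Real.cos (prof k hk α ρ)
        = var k hk α ρ * α / Real.cos (prof k hk α ρ) := by field_simp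
    rw [h3, le_div_iff₀ hc]
    linarith
  have htan : ∀ α, 0 < α → Real.tan (prof k hk α ρ) < 1 := fun α hα => by
    rw [← Real.tan_pi_div_four]
    exact Real.tan_lt_tan_of_lt_of_lt_pi_div_two (by linarith [hapos α hα]) (by linarith)
      (hlt α hα ρ hρ0 (by linarith))
  have ht1 : 0 < Real.tan (prof k hk 1 ρ) :=
    Real.tan_pos_of_pos_of_lt_pi_div_two (hapos 1 one_pos) (hlt2 1 one_pos ρ hρ0 (by linarith))
  have hβ : 1 ≤ 1 / Real.tan (prof k hk 1 ρ) := by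
    rw [le_div_iff₀ ht1, one_mul]; exact (htan 1 one_pos).le
  have hβ0 : 0 < 1 / Real.tan (prof k hk 1 ρ) := by positivity
  have h1 := hmono (mem_Ioi.2 (one_pos (α := ℝ))) hβ0 hβ
  simp only [div_one] at h1
  rw [le_div_iff₀ hβ0, mul_one_div_cancel ht1.ne'] at h1
  linarith [htan _ hβ0]

/-- In dimensions `3 ≤ d ≤ 6` the variation is not positive for all slopes. -/
lemma exists_var_nonpos (k : ℕ) (hk1 : 1 ≤ k) (hk : 2 ≤ k) (hk5 : k ≤ 5) :
    ∃ α, 0 < α ∧ ∃ ρ, 0 < ρ ∧ var k hk1 α ρ ≤ 0 := by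
  obtain ⟨α, r, hα, hr, hrR, har, hlt⟩ := exists_prof_eq_pi_div_four k hk1 (Real.exp_pos (-160))
  refine ⟨α, hα, ?_⟩
  by_contra! hcon
  have := (isVariation_var k hk1 α).exp_lt_of_pos (isFlow_prof k hk1 α) hk hk5 hα hcon hr har hlt
  linarith

/-! ### The shooting argument -/

lemma exists_pos_lower_bound {f : ℝ → ℝ} (hc : ∀ ρ, 0 < ρ → ContinuousAt f ρ)
    (hpos : ∀ ρ, 0 < ρ → 0 < f ρ) {l L : ℝ} (hl : 0 < l) (hL : 0 < L)
    (h0 : Tendsto f (𝓝[>] 0) (𝓝 l)) (hinf : Tendsto f atTop (𝓝 L)) :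
    ∃ δ, 0 < δ ∧ ∀ ρ, 0 < ρ → δ ≤ f ρ := by
  obtain ⟨e, he, h1⟩ := (mem_nhdsGT_iff_exists_Ioo_subset).1
    (h0.eventually (lt_mem_nhds (half_lt_self hl)))
  have he : 0 < e := he
  obtain ⟨N, hN⟩ := eventually_atTop.1 (hinf.eventually (lt_mem_nhds (half_lt_self hL)))
  have hne : (Icc (e / 2) (max N e)).Nonempty := ⟨e / 2, le_rfl, by
    linarith [le_max_right N e]⟩
  have hge : ∀ s ∈ Icc (e / 2) (max N e), 0 < s := fun s hs => (half_pos he).trans_le hs.1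
  obtain ⟨s, hs, hmin⟩ := isCompact_Icc.exists_isMinOn hne
    (fun s hs => (hc s (hge s hs)).continuousWithinAt)
  refine ⟨min (f s) (min (l / 2) (L / 2)), lt_min (hpos s (hge s hs))
    (lt_min (half_pos hl) (half_pos hL)), fun ρ hρ => ?_⟩
  rcases lt_or_ge ρ e with h2 | h2
  · exact ((min_le_right _ _).trans (min_le_left _ _)).trans (h1 ⟨hρ, h2⟩ : l / 2 < f ρ).le
  rcases le_or_gt N ρ with h3 | h3
  · exact ((min_le_right _ _).trans (min_le_right _ _)).trans (hN ρ h3).le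
  · exact (min_le_left _ _).trans (hmin ⟨by linarith, h3.le.trans (le_max_left _ _)⟩)

/-- If the profile stays below `π/2`, then its variation is positive up to and including
infinity. -/
lemma var_pos_of_lt (k : ℕ) (hk : 1 ≤ k) {α : ℝ} (hα : 0 < α)
    (h : ∀ t, 0 < t → prof k hk α t < Real.pi / 2) :
    (∀ ρ, 0 < ρ → 0 < var k hk α ρ) ∧ 0 < varLim k hk α := by
  have hF := isFlow_prof k hk α
  have hv := isVariation_var k hk α
  have hR : ∀ {R : ℝ} t, 0 < t → t < R → prof k hk α t < Real.pi / 2 := fun t ht _ => h t ht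
  have hst := fun ρ (hρ : 0 < ρ) => hv.sturm hF hk hα (R := ρ + 1) hR ρ hρ (by linarith)
  refine ⟨fun ρ hρ => (hst ρ hρ).2, ?_⟩
  have hlim := tendsto_prof k hk α
  have hle : profLim k hk α ≤ Real.pi / 2 := by
    refine le_of_tendsto hlim ?_
    filter_upwards [eventually_gt_atTop 0] with t ht using (h t ht).le
  rcases hle.eq_or_lt with heq | hlt
  · exact hv.lim_pos_of_tendsto_pi_div_two hF hk hα h (heq ▸ hlim) (tendsto_var k hk α)
  · have h1 : prof k hk α 1 ≤ profLim k hk α := by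
      refine ge_of_tendsto hlim ?_
      filter_upwards [eventually_ge_atTop 1] with t ht
      exact hF.monotoneOn_a (r := t) (fun u hu _ => (hF.b_pos hα hR hu le_rfl).le)
        ⟨one_pos, ht⟩ ⟨one_pos.trans_le ht, le_rfl⟩ ht
    have h2 := hF.a_pos hα hR one_pos le_rfl
    have h3 : 0 < Real.sin (2 * profLim k hk α) :=
      Real.sin_pos_of_pos_of_lt_pi (by linarith) (by linarith)
    have h4 : Tendsto (fun t => Real.sin (2 * prof k hk α t) / (2 * α)) atTop
        (𝓝 (Real.sin (2 * profLim k hk α) / (2 * α))) :=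
      ((Real.continuous_sin.tendsto _).comp (hlim.const_mul 2)).div_const _
    refine (div_pos h3 (by positivity)).trans_le
      (le_of_tendsto_of_tendsto h4 (tendsto_var k hk α) ?_)
    filter_upwards [eventually_gt_atTop 0] with t ht using (hst t ht).1

/-- Positivity of the variation on `(0, ∞]` is an open condition on the slope. -/
lemma eventually_var_pos (k : ℕ) (hk : 1 ≤ k) {α : ℝ} (h : ∀ ρ, 0 < ρ → 0 < var k hk α ρ)
    (hlim : 0 < varLim k hk α) : ∀ᶠ a in 𝓝 α, ∀ ρ, 0 < ρ → 0 < var k hk a ρ := by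
  have hv := isVariation_var k hk α
  have h0 : Tendsto (fun ρ => var k hk α ρ / base k ρ) (𝓝[>] 0) (𝓝 (1 / rsq k 0)) := by
    have h1 := hv.tp.div (((continuous_rsq k).tendsto 0).mono_left
      (nhdsWithin_le_nhds (s := Ioi 0))) (rsq_pos k 0).ne'
    refine h1.congr fun ρ => ?_
    simp only [Pi.div_apply, base, div_div]
  obtain ⟨δ, hδ, hle⟩ := exists_pos_lower_bound (f := fun ρ => var k hk α ρ / base k ρ)
    (fun ρ hρ => (hv.dp ρ hρ).continuousAt.div (continuous_base k).continuousAt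
      (base_pos k hρ).ne') (fun ρ hρ => div_pos (h ρ hρ) (base_pos k hρ))
    (one_div_pos.2 (rsq_pos k 0)) (by simpa using hlim) h0
    ((tendsto_var k hk α).div (tendsto_base_atTop k) one_ne_zero)
  filter_upwards [eventually_var_close k hk α hδ] with a ha ρ hρ
  have h1 := (abs_lt.1 (ha ρ hρ)).1
  have h2 := hle ρ hρ
  rw [le_div_iff₀ (base_pos k hρ)] at h2
  linarith

/-- Staying below `π/2` on `[0, ∞]` is an open condition on the slope. -/
lemma eventually_prof_lt (k : ℕ) (hk : 1 ≤ k) {α : ℝ}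
    (h : ∀ ρ, 0 < ρ → prof k hk α ρ < Real.pi / 2) (hlim : profLim k hk α < Real.pi / 2) :
    ∀ᶠ a in 𝓝 α, ∀ ρ, 0 < ρ → prof k hk a ρ < Real.pi / 2 := by
  have hF := isFlow_prof k hk α
  obtain ⟨δ, hδ, hle⟩ := exists_pos_lower_bound (f := fun ρ => Real.pi / 2 - prof k hk α ρ)
    (fun ρ hρ => continuousAt_const.sub (hF.da ρ hρ).continuousAt)
    (fun ρ hρ => sub_pos.2 (h ρ hρ)) (l := Real.pi / 2 - 0) (by linarith [Real.pi_pos])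
    (sub_pos.2 hlim) (hF.tendsto_a.const_sub _) ((tendsto_prof k hk α).const_sub _)
  filter_upwards [eventually_prof_close k hk α hδ] with a ha ρ hρ
  have h1 := (abs_lt.1 (ha ρ hρ.le)).2
  have h2 := hle ρ hρ
  linarith

lemma prof_slope_zero (k : ℕ) (hk : 1 ≤ k) {ρ : ℝ} (hρ : 0 ≤ ρ) : prof k hk 0 ρ = 0 := by
  have h : IsProfile (k + 1) 0 (fun _ => (0 : ℝ)) :=
    ⟨rfl, hasDerivWithinAt_const _ _ _, fun _ _ => differentiableAt_const _,
      fun _ _ => by simp, fun _ _ => by simp⟩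
  exact (isProfile_prof k hk 0).eq_of_nonneg hk h hρ

/-- The slopes `β > 0` such that all profiles of slope in `(0, β)` stay below `π/2`. -/
def slopesBelow (k : ℕ) (hk : 1 ≤ k) : Set ℝ :=
  {β | 0 < β ∧ ∀ α ∈ Ioo 0 β, ∀ ρ, 0 < ρ → prof k hk α ρ < Real.pi / 2}

/-- The slopes `β > 0` such that all variations of slope in `(0, β)` are positive. -/
def slopesMono (k : ℕ) (hk : 1 ≤ k) : Set ℝ :=
  {β | 0 < β ∧ ∀ α ∈ Ioo 0 β, ∀ ρ, 0 < ρ → 0 < var k hk α ρ}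

lemma alphaZero_eq (k : ℕ) (hk : 1 ≤ k) :
    alphaZero (k + 1) = sSup ((fun β : ℝ => (β : EReal)) '' slopesBelow k hk) := by
  unfold alphaZero slopesBelow
  congr 2
  ext β
  refine and_congr_right fun _ => forall₂_congr fun α _ => ⟨fun h ρ hρ => ?_, fun h ρ hρ => ?_⟩
  · rw [← psi_eq_prof k hk α hρ.le]; exact h ρ hρ.le
  · rw [psi_eq_prof k hk α hρ]
    rcases hρ.eq_or_lt with rfl | hρ
    · rw [prof_zero]; linarith [Real.pi_pos]
    · exact h ρ hρ

lemma alphaStar_eq (k : ℕ) (hk : 1 ≤ k) :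
    alphaStar (k + 1) = sSup ((fun β : ℝ => (β : EReal)) '' slopesMono k hk) := by
  unfold alphaStar slopesMono
  congr 2
  ext β
  refine and_congr_right fun _ => forall₂_congr fun α _ => forall₂_congr fun ρ hρ => ?_
  rw [phi_eq_var k hk α hρ.le]

lemma slopesBelow_subset (k : ℕ) (hk : 1 ≤ k) : slopesBelow k hk ⊆ slopesMono k hk :=
  fun _ hβ => ⟨hβ.1, fun α hα => (var_pos_of_lt k hk hα.1 (hβ.2 α hα)).1⟩

lemma slopesBelow_nonempty (k : ℕ) (hk : 1 ≤ k) : (slopesBelow k hk).Nonempty := by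
  have h0 : profLim k hk 0 = 0 := tendsto_nhds_unique (tendsto_prof k hk 0)
    (tendsto_const_nhds.congr' (by
      filter_upwards [eventually_ge_atTop 0] with t ht using (prof_slope_zero k hk ht).symm))
  have h := eventually_prof_lt k hk (α := 0)
    (fun ρ hρ => by rw [prof_slope_zero k hk hρ.le]; linarith [Real.pi_pos])
    (by rw [h0]; linarith [Real.pi_pos])
  obtain ⟨e, he, hsub⟩ := Metric.eventually_nhds_iff.1 h
  refine ⟨e, he, fun α hα => hsub ?_⟩
  rw [Real.dist_eq, sub_zero, abs_of_pos hα.1]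
  exact hα.2

lemma EReal_sSup_coe_image {S : Set ℝ} (hne : S.Nonempty) (hb : BddAbove S) :
    sSup ((fun β : ℝ => (β : EReal)) '' S) = ((sSup S : ℝ) : EReal) := by
  refine le_antisymm (sSup_le ?_) ?_
  · rintro _ ⟨β, hβ, rfl⟩
    exact EReal.coe_le_coe_iff.2 (le_csSup hb hβ)
  · refine le_of_forall_lt fun c hc => ?_
    induction c with
    | bot =>
      obtain ⟨β, hβ⟩ := hne
      exact (EReal.bot_lt_coe β).trans_le (le_sSup ⟨β, hβ, rfl⟩)
    | top => exact absurd hc (not_lt.2 le_top)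
    | coe c =>
      obtain ⟨β, hβ, hcβ⟩ := exists_lt_of_lt_csSup hne (EReal.coe_lt_coe_iff.1 hc)
      exact (EReal.coe_lt_coe_iff.2 hcβ).trans_le (le_sSup ⟨β, hβ, rfl⟩)

lemma EReal_sSup_coe_image_eq_top {S : Set ℝ} (h : ∀ β, 0 < β → β ∈ S) :
    sSup ((fun β : ℝ => (β : EReal)) '' S) = ⊤ := by
  rw [EReal.eq_top_iff_forall_lt]
  intro y
  have h1 : y < |y| + 1 := by linarith [le_abs_self y]
  exact (EReal.coe_lt_coe_iff.2 h1).trans_le (le_sSup ⟨_, h _ (by positivity), rfl⟩)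

lemma slopesMono_bddAbove (k : ℕ) (hk1 : 1 ≤ k) (hk : 2 ≤ k) (hk5 : k ≤ 5) :
    BddAbove (slopesMono k hk1) := by
  obtain ⟨α, hα, ρ, hρ, hle⟩ := exists_var_nonpos k hk1 hk hk5
  refine ⟨α, fun β hβ => ?_⟩
  by_contra! hcon
  exact absurd (hβ.2 α ⟨hα, hcon⟩ ρ hρ) (not_lt.2 hle)

/-- The profile of critical slope `α₀` stays below `π/2`: it cannot touch this value, because it
would cross it with positive speed. -/
lemma prof_sSup_slopesBelow_lt (k : ℕ) (hk : 1 ≤ k) (hb : BddAbove (slopesBelow k hk)) {ρ : ℝ}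
    (hρ : 0 < ρ) : prof k hk (sSup (slopesBelow k hk)) ρ < Real.pi / 2 := by
  set a₀ := sSup (slopesBelow k hk) with ha₀
  have hne := slopesBelow_nonempty k hk
  have ha₀pos : 0 < a₀ := by
    obtain ⟨β, hβ⟩ := hne
    exact hβ.1.trans_le (le_csSup hb hβ)
  have hlt : ∀ α, 0 < α → α < a₀ → ∀ t, 0 < t → prof k hk α t < Real.pi / 2 := by
    intro α hα hαa
    obtain ⟨β, hβ, hαβ⟩ := exists_lt_of_lt_csSup hne hαa
    exact hβ.2 α ⟨hα, hαβ⟩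
  have hle : ∀ t, 0 < t → prof k hk a₀ t ≤ Real.pi / 2 := by
    intro t ht
    refine le_of_tendsto ((hasDerivAt_prof_param k hk a₀ ht.le).continuousAt.continuousWithinAt
      (s := Iio a₀)).tendsto ?_
    filter_upwards [Ioo_mem_nhdsLT ha₀pos] with α hα using (hlt α hα.1 hα.2 t ht).le
  have hF := isFlow_prof k hk a₀
  by_contra! hcon
  obtain ⟨s, hs, -, hs0, hs1⟩ := exists_first_zero (f := fun ρ => Real.pi / 2 - prof k hk a₀ ρ)
    (fun ρ hρ => continuousAt_const.sub (hF.da ρ hρ).continuousAt)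
    ((hF.tendsto_a.const_sub (Real.pi / 2)).eventually
      (lt_mem_nhds (show (0 : ℝ) < Real.pi / 2 - 0 by linarith [Real.pi_pos]))) hρ (by linarith)
  have hbs := hF.b_pos ha₀pos (R := s) (fun t ht hts => by linarith [hs1 t ht hts]) hs le_rfl
  have hmax : IsLocalMax (prof k hk a₀) s := by
    filter_upwards [Ioi_mem_nhds hs] with t ht
    linarith [hle t ht]
  have := hmax.hasDerivAt_eq_zero (hF.da s hs)
  have := div_pos hbs hs
  linarith

/-- The profile of critical slope `α₀` increases to exactly `π/2`. -/
lemma profLim_sSup_slopesBelow (k : ℕ) (hk : 1 ≤ k) (hb : BddAbove (slopesBelow k hk)) :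
    profLim k hk (sSup (slopesBelow k hk)) = Real.pi / 2 := by
  set a₀ := sSup (slopesBelow k hk) with ha₀
  have hne := slopesBelow_nonempty k hk
  have hlt : ∀ t, 0 < t → prof k hk a₀ t < Real.pi / 2 := fun t ht =>
    prof_sSup_slopesBelow_lt k hk hb ht
  have hle : profLim k hk a₀ ≤ Real.pi / 2 := by
    refine le_of_tendsto (tendsto_prof k hk a₀) ?_
    filter_upwards [eventually_gt_atTop 0] with t ht using (hlt t ht).le
  refine hle.eq_of_not_lt fun hcon => ?_
  obtain ⟨e, he, hsub⟩ := Metric.eventually_nhds_iff.1 (eventually_prof_lt k hk hlt hcon)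
  have ha₀pos : 0 < a₀ := by
    obtain ⟨β, hβ⟩ := hne
    exact hβ.1.trans_le (le_csSup hb hβ)
  have hmem : a₀ + e ∈ slopesBelow k hk := by
    refine ⟨by linarith, fun α hα => ?_⟩
    rcases lt_or_ge α a₀ with h | h
    · obtain ⟨β, hβ, hαβ⟩ := exists_lt_of_lt_csSup hne h
      exact hβ.2 α ⟨hα.1, hαβ⟩
    · refine hsub ?_
      rw [Real.dist_eq, abs_of_nonneg (by linarith)]
      linarith [hα.2]
  linarith [le_csSup hb hmem]

lemma varLim_nonneg (k : ℕ) (hk : 1 ≤ k) {α : ℝ} (h : ∀ ρ, 0 < ρ → 0 < var k hk α ρ) :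
    0 ≤ varLim k hk α := by
  refine ge_of_tendsto (tendsto_var k hk α) ?_
  filter_upwards [eventually_gt_atTop 0] with t ht using (h t ht).le

lemma finite_zeros_varLim (k : ℕ) (hk : 1 ≤ k) {a b : ℝ} (ha : varLim k hk a ≠ 0) :
    {α ∈ Icc a b | varLim k hk α = 0}.Finite := by
  by_contra hinf
  obtain ⟨x, -, hx⟩ := Set.Infinite.exists_accPt_of_subset_isCompact hinf isCompact_Icc
    (fun _ h => h.1)
  rw [accPt_iff_frequently_nhdsNE] at hx
  exact ha ((analyticOnNhd_varLim k hk).eqOn_zero_of_preconnected_of_frequently_eq_zero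
    isPreconnected_univ (mem_univ x) (hx.mono fun y hy => hy.2) (mem_univ a))

end Expander

open Expander

theorem proposition2p2 (d : ℕ) (hd : 3 ≤ d) :
    -- the objects are well defined: `ψ_α` is the unique global solution, differentiable in `α`
    (∀ α : ℝ, Expander.IsProfile d α (Expander.psi d α) ∧
      (∀ f : ℝ → ℝ, Expander.IsProfile d α f → ∀ ρ : ℝ, 0 ≤ ρ → f ρ = Expander.psi d α ρ) ∧
      (∀ ρ : ℝ, 0 ≤ ρ → DifferentiableAt ℝ (fun a : ℝ => Expander.psi d a ρ) α)) ∧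
    -- (i)
    (∀ α : ℝ, ∃ L : ℝ, Tendsto (fun ρ : ℝ => Expander.phi d α ρ) atTop (𝓝 L)) ∧
    -- (ii)
    (d ≤ 6 → ∃ a₀ aS : ℝ,
      Expander.alphaZero d = (a₀ : EReal) ∧ Expander.alphaStar d = (aS : EReal) ∧
      0 < a₀ ∧ a₀ < aS ∧
      (∃ l : ℝ, Tendsto (fun ρ : ℝ => Expander.psi d aS ρ) atTop (𝓝 l) ∧ Real.pi / 2 < l) ∧
      ∃ F : Finset ℝ, (F : Set ℝ) ⊆ Set.Ico a₀ aS ∧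
        ∀ α ∈ Set.Ioo 0 aS \ (F : Set ℝ),
          ∃ L : ℝ, Tendsto (fun ρ : ℝ => Expander.phi d α ρ) atTop (𝓝 L) ∧ 0 < L) ∧
    -- (iii)
    (7 ≤ d → Expander.alphaZero d = ⊤ ∧ Expander.alphaStar d = ⊤ ∧
      ∀ α : ℝ, 0 < α →
        ∃ L : ℝ, Tendsto (fun ρ : ℝ => Expander.phi d α ρ) atTop (𝓝 L) ∧ 0 < L) := by
  obtain ⟨k, rfl⟩ : ∃ k, d = k + 1 := ⟨d - 1, by omega⟩
  have hk : 1 ≤ k := by omega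
  have hphi : ∀ α, Tendsto (fun ρ : ℝ => phi (k + 1) α ρ) atTop (𝓝 (varLim k hk α)) := fun α =>
    (tendsto_var k hk α).congr' (by
      filter_upwards [eventually_ge_atTop 0] with ρ hρ using (phi_eq_var k hk α hρ).symm)
  refine ⟨fun α => ⟨psi_isProfile k hk α, fun f hf ρ hρ =>
    hf.eq_of_nonneg hk (psi_isProfile k hk α) hρ,
    fun ρ hρ => (hasDerivAt_psi_param k hk α hρ).differentiableAt⟩,
    fun α => ⟨_, hphi α⟩, fun hd6 => ?_, fun hd7 => ?_⟩
  · have hbS := slopesMono_bddAbove k hk (by omega) (by omega)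
    have hb0 := hbS.mono (slopesBelow_subset k hk)
    have hne := slopesBelow_nonempty k hk
    have hneS := hne.mono (slopesBelow_subset k hk)
    set a₀ := sSup (slopesBelow k hk) with ha₀
    set aS := sSup (slopesMono k hk) with haS
    have hbelow : ∀ α, 0 < α → α < a₀ → ∀ t, 0 < t → prof k hk α t < Real.pi / 2 := by
      intro α hα hαa
      obtain ⟨β, hβ, hαβ⟩ := exists_lt_of_lt_csSup hne hαa
      exact hβ.2 α ⟨hα, hαβ⟩
    have hvar : ∀ α, 0 < α → α < aS → ∀ t, 0 < t → 0 < var k hk α t := by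
      intro α hα hαa
      obtain ⟨β, hβ, hαβ⟩ := exists_lt_of_lt_csSup hneS hαa
      exact hβ.2 α ⟨hα, hαβ⟩
    have ha₀pos : 0 < a₀ := by
      obtain ⟨β, hβ⟩ := hne
      exact hβ.1.trans_le (le_csSup hb0 hβ)
    obtain ⟨hv0, hvl0⟩ := var_pos_of_lt k hk ha₀pos
      fun t ht => prof_sSup_slopesBelow_lt k hk hb0 ht
    have hlt : a₀ < aS := by
      obtain ⟨e, he, hsub⟩ := Metric.eventually_nhds_iff.1 (eventually_var_pos k hk hv0 hvl0)
      have hmem : a₀ + e ∈ slopesMono k hk := by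
        refine ⟨by linarith, fun α hα => ?_⟩
        rcases lt_or_ge α a₀ with h | h
        · exact (var_pos_of_lt k hk hα.1 (hbelow α hα.1 h)).1
        · refine hsub ?_
          rw [Real.dist_eq, abs_of_nonneg (by linarith)]
          linarith [hα.2]
      linarith [le_csSup hbS hmem]
    have hfin : {α | α ∈ Set.Ico a₀ aS ∧ varLim k hk α = 0}.Finite :=
      (finite_zeros_varLim k hk (a := a₀) (b := aS) hvl0.ne').subset
        fun x hx => ⟨⟨hx.1.1, hx.1.2.le⟩, hx.2⟩
    refine ⟨a₀, aS, (alphaZero_eq k hk).trans (EReal_sSup_coe_image hne hb0),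
      (alphaStar_eq k hk).trans (EReal_sSup_coe_image hneS hbS), ha₀pos, hlt,
      ⟨profLim k hk aS, (tendsto_prof k hk aS).congr' (by
        filter_upwards [eventually_ge_atTop 0] with ρ hρ using (psi_eq_prof k hk aS hρ).symm), ?_⟩,
      hfin.toFinset, ?_, ?_⟩
    -- `ψ_α(∞)` is nondecreasing on `[α₀, α*]`; equality at the two ends would make it constant
    · have hmono : MonotoneOn (profLim k hk) (Set.Icc a₀ aS) := by
        refine monotoneOn_of_deriv_nonneg (convex_Icc _ _)
          (fun α _ => (hasDerivAt_profLim k hk α).continuousAt.continuousWithinAt)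
          (fun α _ => (hasDerivAt_profLim k hk α).differentiableAt.differentiableWithinAt) ?_
        intro α hα
        rw [interior_Icc] at hα
        rw [(hasDerivAt_profLim k hk α).deriv]
        exact varLim_nonneg k hk (hvar α (ha₀pos.trans hα.1) hα.2)
      by_contra! hcon
      have hsl := (hasDerivWithinAt_iff_tendsto_slope' (s := Set.Ioi a₀) (by simp)).1
        ((hasDerivAt_profLim k hk a₀).hasDerivWithinAt (s := Set.Ioi a₀))
      have hle : varLim k hk a₀ ≤ 0 := by
        refine le_of_tendsto hsl ?_
        filter_upwards [Ioo_mem_nhdsGT hlt] with α hα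
        have h1 := hmono ⟨hα.1.le, hα.2.le⟩ ⟨hlt.le, le_rfl⟩ hα.2.le
        rw [slope_def_field, profLim_sSup_slopesBelow k hk hb0]
        exact div_nonpos_of_nonpos_of_nonneg (by linarith) (by linarith [hα.1])
      linarith
    · intro x hx
      rw [Set.Finite.coe_toFinset] at hx
      exact hx.1
    · rintro α ⟨hα, hαF⟩
      refine ⟨_, hphi α, ?_⟩
      rcases lt_or_ge α a₀ with h | h
      · exact (var_pos_of_lt k hk hα.1 (hbelow α hα.1 h)).2
      · refine (varLim_nonneg k hk (hvar α hα.1 hα.2)).lt_of_ne' fun h0 => hαF ?_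
        rw [Set.Finite.coe_toFinset]
        exact ⟨⟨h, hα.2⟩, h0⟩
  · have hlt : ∀ α, 0 < α → ∀ t, 0 < t → prof k hk α t < Real.pi / 2 := fun α hα t ht =>
      (isFlow_prof k hk α).lt_pi_div_two_of_six_le (by omega) hα ht
    refine ⟨(alphaZero_eq k hk).trans (EReal_sSup_coe_image_eq_top fun β hβ =>
      ⟨hβ, fun α hα => hlt α hα.1⟩), (alphaStar_eq k hk).trans (EReal_sSup_coe_image_eq_top
      fun β hβ => ⟨hβ, fun α hα => (var_pos_of_lt k hk hα.1 (hlt α hα.1)).1⟩),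
      fun α hα => ⟨_, hphi α, (var_pos_of_lt k hk hα (hlt α hα)).2⟩⟩
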